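/- Let $\alpha>0$ be irrational. Put $\mathcal H=\operatorname{diag}(1,\alpha)^{-1}$ and $M=\tfrac12\begin{bmatrix}1&1\\1&1\end{bmatrix}$, and let $H_\alpha=L^2([0,1];\mathbb R^2)$ be equipped with the norm $\|u\|_{H_\alpha}=\|\mathcal H^{1/2}u\|_{L^2}$. Let $\mathcal A$ be the operator on $H_\alpha$ given by $$\operatorname{dom}\mathcal A=\{u\in H_\alpha:\ \mathcal Hu\in H^1([0,1];\mathbb R^2),\ M(\mathcal Hu)(1)+(\mathcal Hu)(0)=0\},\qquad \mathcal Au=(\mathcal Hu)'.$$ Then $-\mathcal A$ generates a strongly continuous contraction semigroup $\mathcal T^\alpha=(\mathcal T^\alpha(t))_{t\ge0}$ on $H_\alpha$, and $\mathcal T^\alpha$ is not exponentially stable: there are no $K\in\mathbb R$ and $\omega>0$ with $\|\mathcal T^\alpha(t)\|\le Ke^{-\omega t}$ for all $t\ge0$. Moreover, the matrix $T_{t,\alpha}=M\operatorname{diag}(e^{it},e^{i\alpha t})+\mathbf 1_2\in\mathbb C^{2\times2}$ is invertible for every $t\in\mathbb R$, and the function $$m_\alpha(\eta)=\sup_{t\in[-\eta,\eta]}\|T_{t,\alpha}^{-1}\|\qquad(\eta\ge0),$$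 with the operator norm induced by the Euclidean norm, is unbounded on $[0,\infty)$. -/

import Mathlib

open MeasureTheory Set Filter Topology
open scoped Matrix.Norms.L2Operator

noncomputable section

namespace PHS

/-! ### Strongly continuous semigroups -/

/-- A strongly continuous semigroup of bounded linear operators on a real normed space.
Only the values `T t` with `0 ≤ t` are meaningful. -/
structure C0Semigroup (X : Type*) [NormedAddCommGroup X] [NormedSpace ℝ X] where
  /-- the operator at time `t` -/
  op : ℝ → X →L[ℝ] X
  op_zero : op 0 = ContinuousLinearMap.id ℝ X
  op_add : ∀ s t : ℝ, 0 ≤ s → 0 ≤ t → op (s + t) = (op s).comp (op t)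
  strong_cont : ∀ u : X, Tendsto (fun t => op t u) (𝓝[>] 0) (𝓝 u)

/-- `(u, w)` belongs to the graph of the infinitesimal generator of `T`: the difference quotients
`(T t u - u) / t` converge to `w` as `t → 0+`. -/
def C0Semigroup.GeneratorGraph {X : Type*} [NormedAddCommGroup X] [NormedSpace ℝ X]
    (T : C0Semigroup X) (u w : X) : Prop :=
  Tendsto (fun t : ℝ => t⁻¹ • (T.op t u - u)) (𝓝[>] 0) (𝓝 w)

/-! ### The example -/

/-- The Euclidean space `ℝ²`. -/
abbrev R2 : Type := EuclideanSpace ℝ (Fin 2)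

/-- The space `L²([0,1]; ℝ²)`. -/
abbrev State : Type := Lp R2 2 (volume.restrict (Icc (0 : ℝ) 1))

/-- The Hamiltonian density `diag(1, α)⁻¹` (constant in space). -/
def ham (α : ℝ) : Matrix (Fin 2) (Fin 2) ℝ := Matrix.diagonal ![1, α⁻¹]

/-- The matrix `M = ½ [1 1; 1 1]`. -/
def bdM : Matrix (Fin 2) (Fin 2) ℝ := !![1 / 2, 1 / 2; 1 / 2, 1 / 2]

/-- The boundary matrix `W = [M 1]`. -/
def bdW : Matrix (Fin 2) (Fin 2 ⊕ Fin 2) ℝ := Matrix.fromCols bdM 1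

/-- The norm `u ↦ ‖𝓗^{1/2} u‖_{L²}` of the state space, i.e. the square root of
`∫₀¹ ⟪𝓗 u(x), u(x)⟫ dx`. It is equivalent to the `L²` norm when `0 < α`. -/
def energyNorm (α : ℝ) (u : State) : ℝ :=
  Real.sqrt (∫ x in Icc (0 : ℝ) 1, inner ℝ (Matrix.toEuclideanLin (ham α) (u x)) (u x))

/-- `v` is the absolutely continuous representative on `[0,1]` of an element of `H¹([0,1]; ℝ²)`
whose weak derivative is `w ∈ L²([0,1]; ℝ²)`. -/
def IsH1RepWithDeriv (v : ℝ → R2) (w : State) : Prop :=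
  ∀ x ∈ Icc (0 : ℝ) 1, v x = v 0 + ∫ s in (0 : ℝ)..x, w s

/-- The graph of the port-Hamiltonian operator `𝓐` with `P₁ = 1`, `P₀ = 0`:
`𝓗 u ∈ H¹`, `W [(𝓗 u)(1); (𝓗 u)(0)] = 0`, and `w = 𝓐 u = (𝓗 u)'`. Here `v` is the
absolutely continuous representative of `𝓗 u`. -/
def OperatorGraph (α : ℝ) (u w : State) : Prop :=
  ∃ v : ℝ → R2,
    (∀ᵐ x ∂(volume.restrict (Icc (0 : ℝ) 1)), v x = Matrix.toEuclideanLin (ham α) (u x)) ∧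
    IsH1RepWithDeriv v w ∧
    bdW.mulVec (Sum.elim (v 1) (v 0)) = 0

/-- `T` is the semigroup `𝓣^α`: its generator is exactly `-𝓐` (same domain, same values). -/
def IsExampleSemigroup (α : ℝ) (T : C0Semigroup State) : Prop :=
  ∀ u w : State, T.GeneratorGraph u w ↔ OperatorGraph α u (-w)

/-- All operators `T t`, `t ≥ 0`, are contractions for the energy norm. -/
def IsContractive (α : ℝ) (T : C0Semigroup State) : Prop :=
  ∀ t : ℝ, 0 ≤ t → ∀ u : State, energyNorm α (T.op t u) ≤ energyNorm α u

/-- Exponential stability in the operator norm induced by the energy norm: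
`‖T t‖ ≤ K e^{-ω t}` for all `t ≥ 0`, for some `K` and some `ω > 0`. -/
def IsExponentiallyStable (α : ℝ) (T : C0Semigroup State) : Prop :=
  ∃ K ω : ℝ, 0 < ω ∧ ∀ t : ℝ, 0 ≤ t → ∀ u : State,
    energyNorm α (T.op t u) ≤ K * Real.exp (-(ω * t)) * energyNorm α u

/-- The complex matrix `T_{t,α} = M e^{i t 𝓗⁻¹} + 1`, where `𝓗⁻¹ = diag(1, α)`. -/
def charMatrix (α t : ℝ) : Matrix (Fin 2) (Fin 2) ℂ :=
  bdM.map (fun r : ℝ => (r : ℂ)) *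
    Matrix.diagonal ![Complex.exp (Complex.I * t), Complex.exp (Complex.I * (α * t))] + 1

/-- `m_α(η) = sup_{|t| ≤ η} ‖T_{t,α}⁻¹‖`, with the operator norm induced by the Euclidean norm. -/
def growth (α η : ℝ) : ℝ :=
  sSup ((fun t : ℝ => ‖(charMatrix α t)⁻¹‖) '' Icc (-η) η)

end PHS

end

noncomputable section

namespace PHS

/-! ### Limits of semigroups with commuting bounded generators. -/

section BoundedGenerators

variable {X : Type*} [NormedAddCommGroup X] [NormedSpace ℝ X]

/-! Generation. For the energy inner product, `⟨𝓐u, u⟩` is half of `|v(1)|² - |v(0)|²` with `v =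
𝓗u`. The boundary condition gives `v(0) = -Mv(1)`, so this equals `(v₀(1) - v₁(1))²/4 ≥ 0`
(`OperatorGraph.inner_nonneg`). The equation `lu + 𝓐u = f` is solved by variation of constants
(`OperatorGraph.exists_resolvent`). Hille–Yosida, proved here through Yosida approximations
(`exists_contraction_semigroup`), then yields the contraction semigroup.

Failure of decay. Since `α` is irrational, there are odd integers `2p+1`, `2q+1` with `2q+1 -
α(2p+1)` nonzero and arbitrarily small (`exists_odd_mul_sub_odd_lt`). Put `k = π(2p+1)` and `l =
π(2q+1)`. Then `v = (e^{ikx}, e^{ilx})` satisfies the boundary condition exactly, and `u = 𝓗⁻¹v`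
satisfies `𝓐u = iku + O(l - αk)` (`exists_modes`). Hence `T(t)u` stays near `e^{-ikt}u` with error
`O(|l - αk| t)`, so at any prescribed time some state of bounded size has not decayed.

Matrix. The determinant `1 + (e^{it} + e^{iαt})/2` vanishes only if `t` and `αt` are both odd
multiples of `π`, which irrationality excludes. At `t = k` it nearly vanishes: `(1,1)` is an
eigenvector with eigenvalue of size `O(|l - αk|)` (`inv_le_norm_inv_charMatrix`). -/

theorem norm_exp_le_exp_norm (B : X →L[ℝ] X) : ‖NormedSpace.exp B‖ ≤ Real.exp ‖B‖ := by
  rw [NormedSpace.exp_eq_tsum (𝕂 := ℝ), Real.exp_eq_exp_ℝ, NormedSpace.exp_eq_tsum (𝕂 := ℝ)]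
  refine tsum_of_norm_bounded (NormedSpace.expSeries_summable' (𝕂 := ℝ) ‖B‖).hasSum fun n => ?_
  rw [norm_smul, smul_eq_mul, Real.norm_of_nonneg (by positivity)]
  gcongr
  rcases Nat.eq_zero_or_pos n with rfl | hn
  · simp only [pow_zero]
    exact ContinuousLinearMap.norm_id_le
  · exact norm_pow_le' B hn

variable [CompleteSpace X]

theorem hasDerivAt_exp_smul_apply (B : X →L[ℝ] X) (x : X) (t : ℝ) :
    HasDerivAt (fun s : ℝ => NormedSpace.exp (s • B) x) (NormedSpace.exp (t • B) (B x)) t := by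
  have h := (hasDerivAt_exp_smul_const (𝕂 := ℝ) B t)
  simpa using h.clm_apply (hasDerivAt_const t x)

/-- The path `s ↦ e^{sB} e^{(t-s)C} x` joins the two terms; by commutativity its derivative is
`e^{sB} e^{(t-s)C} (B - C)x`, of norm at most `‖Bx - Cx‖`. -/
theorem exp_smul_sub_le {B C : X →L[ℝ] X} (hB : ∀ t : ℝ, 0 ≤ t → ‖NormedSpace.exp (t • B)‖ ≤ 1)
    (hC : ∀ t : ℝ, 0 ≤ t → ‖NormedSpace.exp (t • C)‖ ≤ 1) (hBC : Commute B C) (x : X) {t : ℝ}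
    (ht : 0 ≤ t) :
    ‖NormedSpace.exp (t • B) x - NormedSpace.exp (t • C) x‖ ≤ t * ‖B x - C x‖ := by
  have hder : ∀ s : ℝ, HasDerivAt
      (fun s : ℝ => NormedSpace.exp (s • B) (NormedSpace.exp ((t - s) • C) x))
      (NormedSpace.exp (s • B) (NormedSpace.exp ((t - s) • C) (B x - C x))) s := by
    intro s
    have h1 := hasDerivAt_exp_smul_const (𝕂 := ℝ) B s
    have h2 : HasDerivAt (fun s : ℝ => NormedSpace.exp ((t - s) • C) x)
        (-(NormedSpace.exp ((t - s) • C) (C x))) s := by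
      have := (hasDerivAt_exp_smul_apply C x (t - s)).scomp s ((hasDerivAt_id s).const_sub t)
      simpa [Function.comp_def] using this
    have h3 := h1.clm_apply h2
    convert h3 using 1
    have hc : Commute B (NormedSpace.exp ((t - s) • C)) :=
      ((hBC.smul_right (t - s)).exp_right)
    have := congrArg (fun L : X →L[ℝ] X => L x) hc.eq
    simp only [mul_apply_eq_comp] at this
    simp only [map_sub, map_neg, mul_apply_eq_comp, this]
    abel
  have := norm_image_sub_le_of_norm_deriv_le_segment'
    (f := fun s : ℝ => NormedSpace.exp (s • B) (NormedSpace.exp ((t - s) • C) x))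
    (a := 0) (b := t) (C := ‖B x - C x‖) (fun s _ => (hder s).hasDerivWithinAt) (by
      intro s hs
      refine (ContinuousLinearMap.le_of_opNorm_le _ (hB s hs.1) _).trans ?_
      rw [one_mul]
      exact (ContinuousLinearMap.le_of_opNorm_le _ (hC (t - s) (by linarith [hs.2])) _).trans
        (one_mul _).le) t (right_mem_Icc.2 ht)
  simpa [mul_comm] using this

theorem exp_smul_sub_self_le {B : X →L[ℝ] X}
    (hB : ∀ t : ℝ, 0 ≤ t → ‖NormedSpace.exp (t • B)‖ ≤ 1) (x : X) {t : ℝ} (ht : 0 ≤ t) :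
    ‖NormedSpace.exp (t • B) x - x‖ ≤ t * ‖B x‖ := by
  have := exp_smul_sub_le (C := 0) hB
    (fun t _ => by
      rw [smul_zero, NormedSpace.exp_zero]; exact ContinuousLinearMap.norm_id_le) (Commute.zero_right B) x ht
  simpa using this

theorem exp_smul_sub_taylor_le {B : X →L[ℝ] X} (x : X) {t δ : ℝ} (ht : 0 ≤ t)
    (hδ : ∀ s : ℝ, 0 ≤ s → s ≤ t → ‖NormedSpace.exp (s • B) (B x) - B x‖ ≤ δ) :
    ‖NormedSpace.exp (t • B) x - x - t • B x‖ ≤ t * δ := by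
  have hder : ∀ s : ℝ, HasDerivAt (fun s : ℝ => NormedSpace.exp (s • B) x - s • B x)
      (NormedSpace.exp (s • B) (B x) - B x) s := by
    intro s
    have := (hasDerivAt_id s).smul_const (B x)
    rw [one_smul] at this
    exact (hasDerivAt_exp_smul_apply B x s).sub this
  have := norm_image_sub_le_of_norm_deriv_le_segment' (a := 0) (b := t) (C := δ)
    (fun s _ => (hder s).hasDerivWithinAt) (fun s hs => hδ s hs.1 hs.2.le) t (right_mem_Icc.2 ht)
  simp only [zero_smul, NormedSpace.exp_zero, one_apply_eq_self, sub_zero] at this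
  rw [mul_comm] at this
  convert this using 2
  abel

/-- Semigroups generated by commuting bounded operators converge if the generators converge on a
dense set, and the limits are derivatives of the limit semigroup. -/
theorem exists_semigroup_of_tendsto (B : ℕ → X →L[ℝ] X)
    (hB : ∀ n, ∀ t : ℝ, 0 ≤ t → ‖NormedSpace.exp (t • B n)‖ ≤ 1)
    (hcomm : ∀ m n, Commute (B m) (B n)) (D : X → X → Prop) (hD : Dense {u | ∃ w, D u w})
    (hlim : ∀ u w, D u w → Tendsto (fun n => B n u) atTop (𝓝 w)) :
    ∃ T : C0Semigroup X, (∀ t : ℝ, 0 ≤ t → ∀ u, ‖T.op t u‖ ≤ ‖u‖) ∧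
      ∀ u w, D u w → T.GeneratorGraph u w := by
  have hB' : ∀ n, ∀ t : ℝ, 0 ≤ t → ∀ x, ‖NormedSpace.exp (t • B n) x‖ ≤ ‖x‖ := fun n t ht x =>
    (ContinuousLinearMap.le_of_opNorm_le _ (hB n t ht) x).trans (one_mul _).le
  have happrox : ∀ x : X, ∀ ε > 0, ∃ u w, D u w ∧ ‖x - u‖ < ε := by
    intro x ε hε
    obtain ⟨u, ⟨w, hw⟩, hu⟩ := hD.exists_dist_lt x hε
    exact ⟨u, w, hw, by rwa [dist_eq_norm] at hu⟩
  have hcauchy : ∀ t : ℝ, 0 ≤ t → ∀ x, CauchySeq fun n => NormedSpace.exp (t • B n) x := by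
    intro t ht x
    rw [Metric.cauchySeq_iff]
    intro ε hε
    obtain ⟨u, w, huw, hu⟩ := happrox x (ε / 4) (by positivity)
    have hc := (hlim u w huw).cauchySeq
    rw [Metric.cauchySeq_iff] at hc
    obtain ⟨N, hN⟩ := hc (ε / (2 * (t + 1))) (by positivity)
    refine ⟨N, fun m hm n hn => ?_⟩
    have h1 := hN m hm n hn
    rw [dist_eq_norm] at h1 ⊢
    have h2 := exp_smul_sub_le (hB m) (hB n) (hcomm m n) u ht
    have h3 := hB' m t ht (x - u)
    have h4 := hB' n t ht (x - u)
    have h5 : t * ‖B m u - B n u‖ ≤ ε / 2 := by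
      calc t * ‖B m u - B n u‖ ≤ (t + 1) * (ε / (2 * (t + 1))) := by gcongr; linarith
        _ = ε / 2 := by field_simp
    have h6 : NormedSpace.exp (t • B m) x - NormedSpace.exp (t • B n) x =
        NormedSpace.exp (t • B m) (x - u) - NormedSpace.exp (t • B n) (x - u) +
        (NormedSpace.exp (t • B m) u - NormedSpace.exp (t • B n) u) := by
      simp only [map_sub]; abel
    rw [h6]
    have h7 := norm_add_le (NormedSpace.exp (t • B m) (x - u) - NormedSpace.exp (t • B n) (x - u))
        (NormedSpace.exp (t • B m) u - NormedSpace.exp (t • B n) u)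
    have h8 := norm_sub_le (NormedSpace.exp (t • B m) (x - u)) (NormedSpace.exp (t • B n) (x - u))
    linarith
  have hex : ∀ t : ℝ, ∃ L : X →L[ℝ] X, 0 ≤ t →
      ∀ x, Tendsto (fun n => NormedSpace.exp (t • B n) x) atTop (𝓝 (L x)) := by
    intro t
    by_cases ht : 0 ≤ t
    · choose l hl using fun x => cauchySeq_tendsto_of_complete (hcauchy t ht x)
      exact ⟨continuousLinearMapOfTendsto (fun n => NormedSpace.exp (t • B n))
        (tendsto_pi_nhds.2 hl), fun _ x => hl x⟩
    · exact ⟨0, fun h => absurd h ht⟩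
  choose L hL using hex
  have hLle : ∀ t : ℝ, 0 ≤ t → ∀ x, ‖L t x‖ ≤ ‖x‖ := fun t ht x =>
    le_of_tendsto (hL t ht x).norm (Eventually.of_forall fun n => hB' n t ht x)
  have hdiff : ∀ u w, D u w → ∀ t : ℝ, 0 ≤ t → ‖L t u - u‖ ≤ t * ‖w‖ := fun u w huw t ht =>
    le_of_tendsto_of_tendsto ((hL t ht u).sub_const u).norm ((hlim u w huw).norm.const_mul t)
      (Eventually.of_forall fun n => exp_smul_sub_self_le (hB n) u ht)
  refine ⟨⟨L, ?_, ?_, ?_⟩, hLle, ?_⟩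
  · ext x
    have h := hL 0 le_rfl x
    simp only [zero_smul, NormedSpace.exp_zero, one_apply_eq_self] at h
    exact tendsto_nhds_unique h tendsto_const_nhds
  · intro s t hs ht
    ext x
    have h := hL (s + t) (add_nonneg hs ht) x
    refine tendsto_nhds_unique h ?_
    let _ : NormedAlgebra ℚ (X →L[ℝ] X) := NormedAlgebra.restrictScalars ℚ ℝ _
    have h1 : ∀ n, NormedSpace.exp ((s + t) • B n) x =
        NormedSpace.exp (s • B n) (NormedSpace.exp (t • B n) x - L t x) +
          NormedSpace.exp (s • B n) (L t x) := by
      intro n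
      rw [add_smul, NormedSpace.exp_add_of_commute
        (((Commute.refl (B n)).smul_left s).smul_right t)]
      simp
    simp only [h1, ContinuousLinearMap.comp_apply]
    have h2 : Tendsto (fun n => NormedSpace.exp (s • B n) (NormedSpace.exp (t • B n) x - L t x))
        atTop (𝓝 0) := by
      refine squeeze_zero_norm (fun n => hB' n s hs _) ?_
      simpa using ((hL t ht x).sub_const (L t x)).norm
    simpa using h2.add (hL s hs (L t x))
  · intro x
    rw [Metric.tendsto_nhds]
    intro ε hε
    obtain ⟨u, w, huw, hu⟩ := happrox x (ε / 4) (by positivity)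
    have : ∀ᶠ t : ℝ in 𝓝[>] 0, t < ε / (2 * (‖w‖ + 1)) :=
      mem_nhdsWithin_of_mem_nhds (Iio_mem_nhds (by positivity))
    filter_upwards [this, self_mem_nhdsWithin] with t ht ht0
    have ht0 : 0 < t := ht0
    rw [dist_eq_norm]
    have h1 : L t x - x = L t (x - u) - (x - u) + (L t u - u) := by
      simp only [map_sub]; abel
    have h2 := hdiff u w huw t ht0.le
    have h3 := hLle t ht0.le (x - u)
    have h4 := norm_add_le (L t (x - u) - (x - u)) (L t u - u)
    have h5 := norm_sub_le (L t (x - u)) (x - u)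
    have h6 : t * ‖w‖ < ε / 2 := by
      rw [lt_div_iff₀ (by positivity)] at ht
      nlinarith
    rw [h1]
    linarith
  · intro u w huw
    unfold C0Semigroup.GeneratorGraph
    rw [Metric.tendsto_nhds]
    intro ε hε
    -- `w` need not lie in the domain, so `B n w` may be unbounded in `n`. Replacing it by a nearby
    -- `u'` in the domain keeps the Taylor remainder controlled uniformly in `n`.
    obtain ⟨u', w', huw', hu'⟩ := happrox w (ε / 4) (by positivity)
    have : ∀ᶠ t : ℝ in 𝓝[>] 0, t < ε / (2 * (‖w'‖ + 1)) :=
      mem_nhdsWithin_of_mem_nhds (Iio_mem_nhds (by positivity))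
    filter_upwards [this, self_mem_nhdsWithin] with t ht ht0
    have ht0 : 0 < t := ht0
    have hn : ∀ n, ‖NormedSpace.exp (t • B n) u - u - t • B n u‖ ≤
        t * (2 * ‖B n u - u'‖ + t * ‖B n u'‖) := by
      intro n
      refine exp_smul_sub_taylor_le u ht0.le fun s hs0 hst => ?_
      have h1 : NormedSpace.exp (s • B n) (B n u) - B n u =
          NormedSpace.exp (s • B n) (B n u - u') - (B n u - u') +
            (NormedSpace.exp (s • B n) u' - u') := by
        simp only [map_sub]; abel
      have h2 := exp_smul_sub_self_le (hB n) u' hs0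
      have h3 := hB' n s hs0 (B n u - u')
      have h4 := norm_add_le (NormedSpace.exp (s • B n) (B n u - u') - (B n u - u'))
        (NormedSpace.exp (s • B n) u' - u')
      have h5 := norm_sub_le (NormedSpace.exp (s • B n) (B n u - u')) (B n u - u')
      have h6 : s * ‖B n u'‖ ≤ t * ‖B n u'‖ := by gcongr
      rw [h1]
      linarith
    have hlim' : ‖L t u - u - t • w‖ ≤ t * (2 * ‖w - u'‖ + t * ‖w'‖) :=
      le_of_tendsto_of_tendsto
        (((hL t ht0.le u).sub_const u).sub ((hlim u w huw).const_smul t)).norm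
        (((((hlim u w huw).sub_const u').norm.const_mul 2).add
          ((hlim u' w' huw').norm.const_mul t)).const_mul t)
        (Eventually.of_forall hn)
    rw [dist_eq_norm]
    have h1 : t⁻¹ • (L t u - u) - w = t⁻¹ • (L t u - u - t • w) := by
      rw [smul_sub t⁻¹ _ (t • w), smul_smul, inv_mul_cancel₀ ht0.ne', one_smul]
    have h6 : t * ‖w'‖ < ε / 2 := by
      rw [lt_div_iff₀ (by positivity)] at ht
      nlinarith
    rw [h1, norm_smul, norm_inv, Real.norm_eq_abs, abs_of_pos ht0, inv_mul_lt_iff₀ ht0]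
    refine hlim'.trans_lt (mul_lt_mul_of_pos_left ?_ ht0)
    linarith

/-- Since `e^{tl(J-1)} = e^{-tl} e^{tlJ}`, the scalar factor compensates `‖e^{tlJ}‖ ≤ e^{tl}`. -/
theorem norm_exp_smul_yosida_le {J : X →L[ℝ] X} (hJ : ‖J‖ ≤ 1) {l : ℝ} (hl : 0 ≤ l) {t : ℝ}
    (ht : 0 ≤ t) : ‖NormedSpace.exp (t • (l • (J - 1)))‖ ≤ 1 := by
  have h1 : t • (l • (J - 1)) = (t * l) • J + algebraMap ℝ (X →L[ℝ] X) (-(t * l)) := by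
    rw [Algebra.algebraMap_eq_smul_one, smul_smul, smul_sub, neg_smul, sub_eq_add_neg]
  let _ : NormedAlgebra ℚ (X →L[ℝ] X) := NormedAlgebra.restrictScalars ℚ ℝ _
  rw [h1, NormedSpace.exp_add_of_commute (Algebra.commute_algebraMap_right _ _),
    ← NormedSpace.algebraMap_exp_comm, ← Real.exp_eq_exp_ℝ, Algebra.algebraMap_eq_smul_one,
    mul_smul_comm, mul_one, norm_smul, Real.norm_eq_abs, abs_of_pos (Real.exp_pos _)]
  have h2 : ‖NormedSpace.exp ((t * l) • J)‖ ≤ Real.exp (t * l) := by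
    refine (norm_exp_le_exp_norm _).trans (Real.exp_le_exp.2 ?_)
    rw [norm_smul, Real.norm_of_nonneg (by positivity)]
    exact mul_le_of_le_one_right (by positivity) hJ
  calc Real.exp (-(t * l)) * ‖NormedSpace.exp ((t * l) • J)‖
      ≤ Real.exp (-(t * l)) * Real.exp (t * l) := by gcongr
    _ = 1 := by rw [← Real.exp_add]; simp

end BoundedGenerators

/-! ### Monotone relations and the Hille–Yosida theorem. -/

section MonotoneRelations

variable {X : Type*} [NormedAddCommGroup X] [InnerProductSpace ℝ X]

/-- Pair the equation with `u` and apply Cauchy–Schwarz. With `f = 0` this also gives uniqueness for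
the resolvent equation. -/
theorem norm_le_of_smul_add_eq_smul {u w f : X} (h : 0 ≤ inner ℝ w u) {l : ℝ} (hl : 0 < l)
    (huw : l • u + w = l • f) : ‖u‖ ≤ ‖f‖ := by
  have h1 : inner ℝ w u = l * inner ℝ f u - l * ‖u‖ ^ 2 := by
    rw [← real_inner_self_eq_norm_sq, ← real_inner_smul_left, ← huw, inner_add_left,
      real_inner_smul_left]
    ring
  have h2 := real_inner_le_norm f u
  have h3 : ‖u‖ ^ 2 ≤ ‖f‖ * ‖u‖ := by
    have : l * ‖u‖ ^ 2 ≤ l * inner ℝ f u := by linarith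
    exact (le_of_mul_le_mul_left this hl).trans h2
  by_contra hlt
  push Not at hlt
  nlinarith [norm_nonneg f, norm_nonneg u]

/-- The resolvent `l (l + G)⁻¹` of a monotone linear relation. -/
theorem exists_resolvent (G : Submodule ℝ (X × X)) (hmono : ∀ p ∈ G, 0 ≤ inner ℝ p.2 p.1)
    {l : ℝ} (hl : 0 < l) (hsurj : ∀ f, ∃ u w, (u, w) ∈ G ∧ l • u + w = f) :
    ∃ J : X →L[ℝ] X, ‖J‖ ≤ 1 ∧ (∀ f, (J f, l • (f - J f)) ∈ G) ∧
      ∀ u w, (u, w) ∈ G → J (l • u + w) = l • u := by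
  choose u w hG huw using fun f => hsurj (l • f)
  have huniq : ∀ u' w' f, (u', w') ∈ G → l • u' + w' = l • f → u' = u f := by
    intro u' w' f hG' h
    have h1 := norm_le_of_smul_add_eq_smul (f := 0) (hmono _ (G.sub_mem hG' (hG f))) hl (by
      simp only [Prod.fst_sub, Prod.snd_sub, smul_zero, smul_sub]
      rw [sub_add_sub_comm, h, huw, sub_self])
    rw [norm_zero, norm_le_zero_iff] at h1
    exact sub_eq_zero.1 h1
  let J₀ : X →ₗ[ℝ] X :=
    { toFun := u
      map_add' := fun f g => (huniq _ _ (f + g) (G.add_mem (hG f) (hG g)) (by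
        simp only [smul_add]
        rw [add_add_add_comm, huw, huw])).symm
      map_smul' := fun c f => (huniq _ _ (c • f) (G.smul_mem c (hG f)) (by
        simp only [smul_comm l c, ← smul_add]
        rw [huw])).symm }
  have hw : ∀ f, w f = l • (f - u f) := fun f => by
    rw [smul_sub, ← huw]; abel
  refine ⟨J₀.mkContinuous 1 fun f => ?_, LinearMap.mkContinuous_norm_le _ zero_le_one _,
    fun f => ?_, fun u' w' h => ?_⟩
  · rw [one_mul]
    exact norm_le_of_smul_add_eq_smul (hmono _ (hG f)) hl (huw f)
  · have := hG f
    rw [hw] at this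
    exact this
  · exact (huniq (l • u') (l • w') (l • u' + w') (G.smul_mem l h) (smul_add _ _ _).symm).symm

variable [CompleteSpace X]

/-- The Hille–Yosida theorem for `-G`, where `G` is (the graph of) a monotone linear operator
on a Hilbert space such that `l + G` is surjective for all `l > 0`. -/
theorem exists_contraction_semigroup (G : Submodule ℝ (X × X))
    (hmono : ∀ p ∈ G, 0 ≤ inner ℝ p.2 p.1)
    (hsurj : ∀ l : ℝ, 0 < l → ∀ f, ∃ u w, (u, w) ∈ G ∧ l • u + w = f)
    (hsv : ∀ w, ((0 : X), w) ∈ G → w = 0) :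
    ∃ T : C0Semigroup X, (∀ t : ℝ, 0 ≤ t → ∀ u, ‖T.op t u‖ ≤ ‖u‖) ∧
      ∀ u w, T.GeneratorGraph u w ↔ (u, -w) ∈ G := by
  have hl : ∀ n : ℕ, (0 : ℝ) < n + 1 := fun n => by positivity
  choose J hJ1 hJG hJ using fun n : ℕ => exists_resolvent G hmono (hl n) (hsurj _ (hl n))
  have hdense : Dense {u | ∃ w, (u, -w) ∈ G} := by
    let D : Submodule ℝ X := G.map (LinearMap.fst ℝ X X)
    have hD : {u | ∃ w, (u, -w) ∈ G} = (D : Set X) := by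
      ext u
      simp only [mem_ofPred_eq, SetLike.mem_coe, D, Submodule.mem_map, LinearMap.fst_apply]
      constructor
      · rintro ⟨w, hw⟩
        exact ⟨_, hw, rfl⟩
      · rintro ⟨⟨u', w⟩, hw, rfl⟩
        exact ⟨-w, by simpa using hw⟩
    rw [hD, Submodule.dense_iff_topologicalClosure_eq_top,
      Submodule.topologicalClosure_eq_top_iff, Submodule.eq_bot_iff]
    -- Write `y ⟂ dom` as `y = u + w` with `(u, w) ∈ G`. Then `0 = ⟨u, y⟩ = ‖u‖² + ⟨w, u⟩` forces `u
    -- = 0`, and single-valuedness gives `w = 0`.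
    intro y hy
    obtain ⟨u, w, huw, h⟩ := hsurj 1 one_pos y
    have h1 : inner ℝ u y = 0 := hy u ⟨_, huw, rfl⟩
    have h2 := hmono _ huw
    rw [one_smul] at h
    rw [← h, inner_add_right, real_inner_comm] at h1
    have h3 : u = 0 := by
      have : inner ℝ u u ≤ 0 := by linarith [real_inner_comm u w]
      exact real_inner_self_nonpos.1 this
    subst h3
    rw [← h, hsv w huw, add_zero]
  have hJcomm : ∀ m n, Commute (J m) (J n) := by
    intro m n
    rcases eq_or_ne m n with rfl | hmn
    · exact Commute.refl _
    ext f
    have h1 := hJ n _ _ (hJG m f)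
    have h2 := hJ m _ _ (hJG n f)
    simp only [map_add, map_smul, map_sub] at h1 h2
    rw [mul_apply_eq_comp, mul_apply_eq_comp, ← sub_eq_zero]
    -- Adding the two resolvent identities cancels every term except a multiple of the commutator.
    have h3 : ((m : ℝ) - n) • (J m (J n f) - J n (J m f)) = 0 := by
      linear_combination (norm := module) h1 + h2
    exact (smul_eq_zero.1 h3).resolve_left (sub_ne_zero.2 (by exact_mod_cast hmn))
  let B : ℕ → X →L[ℝ] X := fun n => ((n : ℝ) + 1) • (J n - 1)
  have hBu : ∀ n u w, (u, -w) ∈ G → B n u = J n w := by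
    intro n u w h
    have h1 := hJ n _ _ h
    have h2 : B n u = ((n : ℝ) + 1) • (J n u - u) := by simp [B]
    rw [map_add, map_smul, map_neg] at h1
    rw [h2, smul_sub, ← h1]
    abel
  have hJlim : ∀ x, Tendsto (fun n => J n x) atTop (𝓝 x) := by
    intro x
    rw [Metric.tendsto_atTop]
    intro ε hε
    obtain ⟨u, ⟨w, huw⟩, hu⟩ := hdense.exists_dist_lt x (show 0 < ε / 4 by positivity)
    obtain ⟨N, hN⟩ := exists_nat_gt (‖w‖ / (ε / 4))
    refine ⟨N, fun n hn => ?_⟩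
    have h1 : J n u - u = ((n : ℝ) + 1)⁻¹ • J n w := by
      rw [← hBu n u w huw]
      simp [B, smul_smul, inv_mul_cancel₀ (hl n).ne']
    have hc : ∀ y, ‖J n y‖ ≤ ‖y‖ := fun y =>
      (ContinuousLinearMap.le_of_opNorm_le _ (hJ1 n) y).trans (one_mul _).le
    have h2 : ‖J n u - u‖ ≤ ε / 4 := by
      rw [h1, norm_smul, norm_inv, Real.norm_of_nonneg (hl n).le, inv_mul_le_iff₀ (hl n)]
      refine (hc w).trans ?_
      rw [div_lt_iff₀ (by positivity)] at hN
      have : (N : ℝ) ≤ n := by exact_mod_cast hn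
      nlinarith
    rw [dist_eq_norm] at hu ⊢
    have h3 : J n x - x = J n (x - u) - (x - u) + (J n u - u) := by
      simp only [map_sub]; abel
    have h4 := norm_add_le (J n (x - u) - (x - u)) (J n u - u)
    have h5 := norm_sub_le (J n (x - u)) (x - u)
    have h6 := hc (x - u)
    rw [h3]
    linarith
  obtain ⟨T, hT1, hT2⟩ := exists_semigroup_of_tendsto B
    (fun n t ht => norm_exp_smul_yosida_le (hJ1 n) (hl n).le ht)
    (fun m n => (((hJcomm m n).sub_left (Commute.one_left _)).sub_right
      (Commute.one_right _)).smul_left _ |>.smul_right _)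
    (fun u w => (u, -w) ∈ G) hdense (fun u w huw => by
      simp only [hBu _ u w huw]
      exact hJlim w)
  refine ⟨T, hT1, fun u w => ⟨fun h => ?_, hT2 u w⟩⟩
  -- Maximality: `(u₀, w₀) ∈ G` is chosen so that the generator of `T` maps `u - u₀` to itself. A
  -- contraction semigroup has a dissipative generator, hence `u = u₀` and `-w = w₀`.
  obtain ⟨u₀, w₀, h₀, h₀'⟩ := hsurj 1 one_pos (u - w)
  have h₁ := hT2 u₀ (-w₀) (by simpa using h₀)
  have hd : w + w₀ = u - u₀ := by
    rw [one_smul] at h₀'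
    rw [eq_sub_iff_add_eq, add_assoc, add_comm w₀, h₀']
    abel
  have hgen : T.GeneratorGraph (u - u₀) (u - u₀) := by
    have := h.sub h₁
    rw [sub_neg_eq_add, hd] at this
    refine this.congr fun t => ?_
    rw [map_sub, ← smul_sub]
    congr 1
    abel
  have h2 : inner ℝ (u - u₀) (u - u₀) ≤ 0 := by
    refine le_of_tendsto (hgen.inner tendsto_const_nhds) ?_
    filter_upwards [self_mem_nhdsWithin] with t ht
    have ht : 0 < t := ht
    rw [real_inner_smul_left, inner_sub_left]
    have h3 := real_inner_le_norm (T.op t (u - u₀)) (u - u₀)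
    have h4 := mul_le_mul_of_nonneg_right (hT1 t ht.le (u - u₀)) (norm_nonneg (u - u₀))
    rw [real_inner_self_eq_norm_mul_norm]
    exact mul_nonpos_of_nonneg_of_nonpos (by positivity) (by linarith)
  have h3 := real_inner_self_nonpos.1 h2
  have h4 : -w = w₀ := by
    rw [h3, add_eq_zero_iff_eq_neg] at hd
    rw [hd, neg_neg]
  rw [sub_eq_zero.1 h3, h4]
  exact h₀

end MonotoneRelations

/-! ### Calculus for primitives of integrable functions. -/

section Primitives

/-- The product rule for primitives of integrable functions. -/
theorem integral_mul_add_mul_eq_sub {F G f g : ℝ → ℝ} {b : ℝ}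
    (hf : IntervalIntegrable f volume 0 b) (hg : IntervalIntegrable g volume 0 b)
    (hF : ∀ x ∈ uIcc 0 b, F x = F 0 + ∫ s in (0 : ℝ)..x, f s)
    (hG : ∀ x ∈ uIcc 0 b, G x = G 0 + ∫ s in (0 : ℝ)..x, g s) :
    ∫ s in (0 : ℝ)..b, (f s * G s + F s * g s) = F b * G b - F 0 * G 0 := by
  have hac : ∀ {f : ℝ → ℝ} (c : ℝ), IntervalIntegrable f volume 0 b →
      AbsolutelyContinuousOnInterval (fun x => c + ∫ s in (0 : ℝ)..x, f s) 0 b := fun c hf =>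
    (contDiffOn_const (n := 1)).absolutelyContinuousOnInterval.add
      (hf.absolutelyContinuousOnInterval_intervalIntegral left_mem_uIcc)
  have h := (hac (F 0) hf).integral_deriv_mul_eq_sub (hac (G 0) hg)
  rw [← hF b right_mem_uIcc, ← hG b right_mem_uIcc, ← hF 0 left_mem_uIcc,
    ← hG 0 left_mem_uIcc] at h
  rw [← h]
  refine intervalIntegral.integral_congr_ae ?_
  filter_upwards [hf.ae_hasDerivAt_integral, hg.ae_hasDerivAt_integral] with x h1 h2 hx
  have hx := uIoc_subset_uIcc hx
  rw [((h1 hx 0 left_mem_uIcc).const_add (F 0)).deriv,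
    ((h2 hx 0 left_mem_uIcc).const_add (G 0)).deriv, hF x hx, hG x hx]

/-- Lebesgue differentiation: almost everywhere `f` is the derivative of its primitive, which
vanishes near each interior point. -/
theorem ae_eq_zero_of_integral_eq_zero {f : ℝ → ℝ} {b : ℝ} (hb : 0 ≤ b)
    (hf : IntervalIntegrable f volume 0 b)
    (h : ∀ x ∈ Icc 0 b, ∫ s in (0 : ℝ)..x, f s = 0) :
    ∀ᵐ x ∂(volume.restrict (Icc 0 b)), f x = 0 := by
  have hI : (volume.restrict (Icc (0 : ℝ) b)) = volume.restrict (Ioo 0 b) :=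
    (Measure.restrict_congr_set Ioo_ae_eq_Icc).symm
  rw [hI, ae_restrict_iff' measurableSet_Ioo]
  filter_upwards [hf.ae_hasDerivAt_integral] with x hx hxb
  have h1 := hx (by rw [uIcc_of_le hb]; exact Ioo_subset_Icc_self hxb) 0 left_mem_uIcc
  refine h1.unique ?_
  refine (hasDerivAt_const x (0 : ℝ)).congr_of_eventuallyEq ?_
  filter_upwards [isOpen_Ioo.mem_nhds hxb] with y hy
  exact h y (Ioo_subset_Icc_self hy)

/-- Variation of constants. -/
theorem exp_mul_primitive_eq {f : ℝ → ℝ} {b : ℝ} (hf : IntervalIntegrable f volume 0 b)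
    (k c : ℝ) :
    Real.exp (-(k * b)) * (c + ∫ s in (0 : ℝ)..b, Real.exp (k * s) * f s) =
      c + ∫ s in (0 : ℝ)..b, (f s - k * (Real.exp (-(k * s)) *
        (c + ∫ r in (0 : ℝ)..s, Real.exp (k * r) * f r))) := by
  have hg : IntervalIntegrable (fun s => Real.exp (k * s) * f s) volume 0 b :=
    hf.continuousOn_mul (by fun_prop)
  have he : Continuous fun s : ℝ => -k * Real.exp (-(k * s)) := by fun_prop
  have hF : ∀ x : ℝ, Real.exp (-(k * x)) = Real.exp (-(k * 0)) +
      ∫ s in (0 : ℝ)..x, -k * Real.exp (-(k * s)) := by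
    intro x
    rw [intervalIntegral.integral_eq_sub_of_hasDerivAt (f := fun s => Real.exp (-(k * s)))
      (fun s _ => ?_) (he.intervalIntegrable _ _)]
    · ring
    · have := (((hasDerivAt_id s).const_mul k).neg).exp
      simpa [mul_comm] using this
  -- The claim is the integrated form of `V' = f - kV`, `V(0) = c`; the product rule for primitives
  -- lets `f` be merely integrable.
  have h := integral_mul_add_mul_eq_sub (F := fun x => Real.exp (-(k * x)))
    (G := fun x => c + ∫ s in (0 : ℝ)..x, Real.exp (k * s) * f s)
    (he.intervalIntegrable 0 b) hg (fun x _ => hF x) (fun x _ => by simp)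
  simp only [mul_zero, neg_zero, Real.exp_zero, intervalIntegral.integral_same, add_zero,
    one_mul] at h
  rw [← sub_eq_iff_eq_add', ← h]
  congr 1
  ext s
  have : Real.exp (-(k * s)) * Real.exp (k * s) = 1 := by rw [← Real.exp_add]; simp
  linear_combination f s * this

end Primitives

/-! ### The state space and its energy norm. -/

section StateSpace

theorem Icc_zero_subset_Icc {x : ℝ} (hx : x ∈ Icc (0 : ℝ) 1) : Icc 0 x ⊆ Icc (0 : ℝ) 1 :=
  Icc_subset_Icc_right hx.2

theorem State.integrable (w : State) : Integrable w (volume.restrict (Icc (0 : ℝ) 1)) :=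
  (Lp.memLp w).integrable (by norm_num)

theorem State.intervalIntegrable (w : State) {x : ℝ} (hx : x ∈ Icc (0 : ℝ) 1) :
    IntervalIntegrable w volume 0 x := by
  rw [intervalIntegrable_iff_integrableOn_Icc_of_le hx.1]
  exact IntegrableOn.mono_set (State.integrable w) (Icc_zero_subset_Icc hx)

theorem State.memLp_coord (w : State) (i : Fin 2) :
    MemLp (fun s => w s i) 2 (volume.restrict (Icc (0 : ℝ) 1)) :=
  (EuclideanSpace.proj (𝕜 := ℝ) i).comp_memLp' (Lp.memLp w)

theorem State.intervalIntegrable_coord (w : State) (i : Fin 2) {x : ℝ}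
    (hx : x ∈ Icc (0 : ℝ) 1) : IntervalIntegrable (fun s => w s i) volume 0 x := by
  rw [intervalIntegrable_iff_integrableOn_Icc_of_le hx.1]
  exact IntegrableOn.mono_set ((State.memLp_coord w i).integrable (by norm_num))
    (Icc_zero_subset_Icc hx)

theorem State.integral_coord (w : State) (i : Fin 2) {x : ℝ} (hx : x ∈ Icc (0 : ℝ) 1) :
    (∫ s in (0 : ℝ)..x, w s) i = ∫ s in (0 : ℝ)..x, w s i :=
  ((EuclideanSpace.proj (𝕜 := ℝ) i).intervalIntegral_comp_comm
    (State.intervalIntegrable w hx)).symm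

theorem State.ext_coord {u w : State}
    (h : ∀ i, ∀ᵐ x ∂(volume.restrict (Icc (0 : ℝ) 1)), u x i = w x i) : u = w := by
  refine Lp.ext ?_
  filter_upwards [ae_all_iff.2 h] with x hx
  ext i
  exact hx i

theorem State.exists_of_continuousOn (g : Fin 2 → ℝ → ℝ)
    (hg : ∀ i, ContinuousOn (g i) (Icc 0 1)) :
    ∃ u : State, ∀ i, ∀ᵐ x ∂(volume.restrict (Icc (0 : ℝ) 1)), u x i = g i x := by
  have hc : ContinuousOn (fun x => (WithLp.toLp 2 (fun i => g i x) : R2)) (Icc 0 1) :=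
    (PiLp.continuous_toLp 2 _).comp_continuousOn (continuousOn_pi.2 hg)
  have hm : MemLp (fun x => (WithLp.toLp 2 (fun i => g i x) : R2)) 2
      (volume.restrict (Icc (0 : ℝ) 1)) := by
    obtain ⟨C, hC⟩ := isCompact_Icc.exists_bound_of_continuousOn hc
    refine MemLp.of_bound (hc.aestronglyMeasurable measurableSet_Icc) C ?_
    rw [ae_restrict_iff' measurableSet_Icc]
    exact Eventually.of_forall hC
  refine ⟨hm.toLp, fun i => ?_⟩
  filter_upwards [hm.coeFn_toLp] with x hx
  rw [hx]

/-- Multiplication of the two components by constants. -/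
def scale (c : Fin 2 → ℝ) : State →L[ℝ] State :=
  (Matrix.toEuclideanLin (Matrix.diagonal c)).toContinuousLinearMap.compLpL 2 _

theorem scale_coord (c : Fin 2 → ℝ) (u : State) :
    ∀ᵐ x ∂(volume.restrict (Icc (0 : ℝ) 1)), ∀ i, scale c u x i = c i * u x i := by
  filter_upwards [ContinuousLinearMap.coeFn_compLpL (p := 2)
    (Matrix.toEuclideanLin (Matrix.diagonal c)).toContinuousLinearMap u] with x hx i
  rw [scale, hx]
  exact Matrix.mulVec_diagonal c (u x) i

theorem scale_scale {c d : Fin 2 → ℝ} (h : ∀ i, c i * d i = 1) (u : State) :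
    scale c (scale d u) = u := by
  refine State.ext_coord fun i => ?_
  filter_upwards [scale_coord c (scale d u), scale_coord d u] with x h1 h2
  rw [h1, h2, ← mul_assoc, h, one_mul]

/-- Multiplication by the square root of the Hamiltonian density. -/
def sqrtHam {α : ℝ} (hα : 0 < α) : State ≃L[ℝ] State :=
  ContinuousLinearEquiv.equivOfInverse (scale ![1, (√α)⁻¹]) (scale ![1, √α])
    (fun u => scale_scale (by
      have := (Real.sqrt_pos.2 hα).ne'
      intro i; fin_cases i <;> simp [this]) u)
    (fun u => scale_scale (by
      have := (Real.sqrt_pos.2 hα).ne'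
      intro i; fin_cases i <;> simp [this]) u)

theorem sqrtHam_coord {α : ℝ} (hα : 0 < α) (u : State) :
    ∀ᵐ x ∂(volume.restrict (Icc (0 : ℝ) 1)),
      sqrtHam hα u x 0 = u x 0 ∧ sqrtHam hα u x 1 = (√α)⁻¹ * u x 1 := by
  filter_upwards [scale_coord ![1, (√α)⁻¹] u] with x hx
  exact ⟨(hx 0).trans (one_mul _), hx 1⟩

theorem inner_sqrtHam {α : ℝ} (hα : 0 < α) (u w : State) :
    inner ℝ (sqrtHam hα u) (sqrtHam hα w) =
      ∫ x in Icc (0 : ℝ) 1, (u x 0 * w x 0 + α⁻¹ * (u x 1 * w x 1)) := by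
  rw [L2.inner_def]
  refine integral_congr_ae ?_
  filter_upwards [sqrtHam_coord hα u, sqrtHam_coord hα w] with x hu hw
  have h : (√α)⁻¹ * (√α)⁻¹ = α⁻¹ := by rw [← mul_inv, Real.mul_self_sqrt hα.le]
  simp only [PiLp.inner_apply, Fin.sum_univ_two, hu.1, hu.2, hw.1, hw.2, RCLike.inner_apply,
    conj_trivial]
  linear_combination u x 1 * w x 1 * h

theorem ham_coord (α : ℝ) (y : R2) :
    Matrix.toEuclideanLin (ham α) y 0 = y 0 ∧ Matrix.toEuclideanLin (ham α) y 1 = α⁻¹ * y 1 := by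
  constructor <;> simp [ham, Matrix.toLpLin_apply]

theorem energyNorm_eq {α : ℝ} (hα : 0 < α) (u : State) :
    energyNorm α u = ‖sqrtHam hα u‖ := by
  rw [norm_eq_sqrt_real_inner, inner_sqrtHam, energyNorm]
  congr 2
  ext x
  simp only [PiLp.inner_apply, Fin.sum_univ_two, ham_coord, RCLike.inner_apply, conj_trivial]
  ring

end StateSpace

/-! ### The port-Hamiltonian operator: linearity, monotonicity, range. -/

section OperatorGraph

theorem bdW_mulVec_eq_zero_iff (y z : R2) :
    bdW.mulVec (Sum.elim y z) = 0 ↔ z 0 = -(y 0 + y 1) / 2 ∧ z 1 = -(y 0 + y 1) / 2 := by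
  rw [bdW, Matrix.fromCols_mulVec, Matrix.one_mulVec, funext_iff, Fin.forall_fin_two]
  simp only [bdM, Pi.add_apply, Matrix.mulVec, dotProduct, Fin.sum_univ_two, Pi.zero_apply,
    Function.comp_apply, Sum.elim_inl, Sum.elim_inr]
  simp
  constructor <;> rintro ⟨h1, h2⟩ <;> constructor <;> linarith

/-- Scalar form with `v = (p, q)`, to which one-variable calculus applies. As `M` has equal rows,
both components of `v(0)` have the same value. -/
theorem operatorGraph_iff {α : ℝ} (u w : State) :
    OperatorGraph α u w ↔ ∃ p q : ℝ → ℝ,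
      ((∀ᵐ x ∂(volume.restrict (Icc (0 : ℝ) 1)), p x = u x 0) ∧
        ∀ᵐ x ∂(volume.restrict (Icc (0 : ℝ) 1)), q x = α⁻¹ * u x 1) ∧
      (∀ x ∈ Icc (0 : ℝ) 1, p x = p 0 + ∫ s in (0 : ℝ)..x, w s 0) ∧
      (∀ x ∈ Icc (0 : ℝ) 1, q x = q 0 + ∫ s in (0 : ℝ)..x, w s 1) ∧
      p 0 = -(p 1 + q 1) / 2 ∧ q 0 = -(p 1 + q 1) / 2 := by
  constructor
  · rintro ⟨v, h1, h2, h3⟩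
    rw [bdW_mulVec_eq_zero_iff] at h3
    refine ⟨fun x => v x 0, fun x => v x 1, ⟨?_, ?_⟩, fun x hx => ?_, fun x hx => ?_, h3⟩
    · filter_upwards [h1] with x hx
      rw [hx, (ham_coord α _).1]
    · filter_upwards [h1] with x hx
      rw [hx, (ham_coord α _).2]
    · simp only
      rw [h2 x hx, PiLp.add_apply, State.integral_coord w 0 hx]
    · simp only
      rw [h2 x hx, PiLp.add_apply, State.integral_coord w 1 hx]
  · rintro ⟨p, q, ⟨h1, h2⟩, h3, h4, h5⟩
    refine ⟨fun x => !₂[p x, q x], ?_, fun x hx => ?_, ?_⟩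
    · filter_upwards [h1, h2] with x hp hq
      ext i
      fin_cases i
      · exact hp.trans (ham_coord α _).1.symm
      · exact hq.trans (ham_coord α _).2.symm
    · ext i
      rw [PiLp.add_apply, State.integral_coord w i hx]
      fin_cases i
      · exact h3 x hx
      · exact h4 x hx
    · rw [bdW_mulVec_eq_zero_iff]
      exact h5

theorem State.intervalIntegral_congr {f g : ℝ → ℝ} {x : ℝ} (hx : x ∈ Icc (0 : ℝ) 1)
    (h : ∀ᵐ s ∂(volume.restrict (Icc (0 : ℝ) 1)), f s = g s) :
    ∫ s in (0 : ℝ)..x, f s = ∫ s in (0 : ℝ)..x, g s := by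
  refine intervalIntegral.integral_congr_ae ?_
  rw [ae_restrict_iff' measurableSet_Icc] at h
  filter_upwards [h] with s hs hsx
  rw [uIoc_of_le hx.1] at hsx
  exact hs ⟨hsx.1.le, hsx.2.trans hx.2⟩

theorem State.add_smul_coord (u w : State) (c : ℝ) :
    ∀ᵐ x ∂(volume.restrict (Icc (0 : ℝ) 1)), ∀ i, (u + c • w : State) x i = u x i + c * w x i := by
  filter_upwards [Lp.coeFn_add u (c • w), Lp.coeFn_smul c w] with x h1 h2 i
  rw [h1, Pi.add_apply, h2]
  rfl

theorem State.zero_coord :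
    ∀ᵐ x ∂(volume.restrict (Icc (0 : ℝ) 1)), ∀ i, (0 : State) x i = 0 := by
  filter_upwards [Lp.coeFn_zero R2 2 (volume.restrict (Icc (0 : ℝ) 1))] with x hx i
  rw [hx]
  rfl

theorem State.integral_add_smul (u w : State) (c : ℝ) (i : Fin 2) {x : ℝ}
    (hx : x ∈ Icc (0 : ℝ) 1) :
    ∫ s in (0 : ℝ)..x, (u + c • w : State) s i =
      (∫ s in (0 : ℝ)..x, u s i) + c * ∫ s in (0 : ℝ)..x, w s i := by
  rw [State.intervalIntegral_congr hx (g := fun s => u s i + c * w s i)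
    ((State.add_smul_coord u w c).mono fun s hs => hs i),
    intervalIntegral.integral_add (State.intervalIntegrable_coord u i hx)
      ((State.intervalIntegrable_coord w i hx).const_mul c), intervalIntegral.integral_const_mul]

theorem OperatorGraph.zero (α : ℝ) : OperatorGraph α 0 0 := by
  rw [operatorGraph_iff]
  have h : ∀ i, ∀ x ∈ Icc (0 : ℝ) 1, (0 : ℝ) = 0 + ∫ s in (0 : ℝ)..x, (0 : State) s i := by
    intro i x hx
    rw [State.intervalIntegral_congr hx (g := fun _ => 0)
      (State.zero_coord.mono fun s hs => hs i)]
    simp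
  refine ⟨fun _ => 0, fun _ => 0, ⟨?_, ?_⟩, h 0, h 1, by simp, by simp⟩
  · filter_upwards [State.zero_coord] with x hx
    rw [hx]
  · filter_upwards [State.zero_coord] with x hx
    rw [hx, mul_zero]

theorem OperatorGraph.add_smul {α : ℝ} {u w u' w' : State} (h : OperatorGraph α u w)
    (h' : OperatorGraph α u' w') (c : ℝ) : OperatorGraph α (u + c • u') (w + c • w') := by
  rw [operatorGraph_iff] at *
  obtain ⟨p, q, ⟨h1, h2⟩, h3, h4, h5, h6⟩ := h
  obtain ⟨p', q', ⟨h1', h2'⟩, h3', h4', h5', h6'⟩ := h'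
  refine ⟨fun x => p x + c * p' x, fun x => q x + c * q' x, ⟨?_, ?_⟩, fun x hx => ?_,
    fun x hx => ?_, ?_, ?_⟩
  · filter_upwards [h1, h1', State.add_smul_coord u u' c] with x hp hp' hx
    rw [hx, hp, hp']
  · filter_upwards [h2, h2', State.add_smul_coord u u' c] with x hp hp' hx
    rw [hx, hp, hp']
    ring
  · simp only
    rw [State.integral_add_smul w w' c 0 hx, h3 x hx, h3' x hx]
    ring
  · simp only
    rw [State.integral_add_smul w w' c 1 hx, h4 x hx, h4' x hx]
    ring
  · simp only
    rw [h5, h5']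
    ring
  · simp only
    rw [h6, h6']
    ring

/-- The graph of the port-Hamiltonian operator as a subspace. -/
def operatorSubmodule (α : ℝ) : Submodule ℝ (State × State) where
  carrier := {p | OperatorGraph α p.1 p.2}
  zero_mem' := OperatorGraph.zero α
  add_mem' := fun {a b} ha hb => by
    have := OperatorGraph.add_smul ha hb 1
    rwa [one_smul, one_smul] at this
  smul_mem' := fun c a ha => by
    have := OperatorGraph.add_smul (OperatorGraph.zero α) ha c
    rwa [zero_add, zero_add] at this

/-- Single-valuedness of the graph: the representative `v` is continuous on `[0,1]`, so vanishing
almost everywhere makes it vanish there, and so does its weak derivative. -/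
theorem OperatorGraph.eq_zero {α : ℝ} {w : State} (h : OperatorGraph α 0 w) : w = 0 := by
  rw [operatorGraph_iff] at h
  obtain ⟨p, q, ⟨h1, h2⟩, h3, h4, h5, h6⟩ := h
  have key : ∀ (i : Fin 2) (f : ℝ → ℝ), (∀ᵐ x ∂(volume.restrict (Icc (0 : ℝ) 1)), f x = 0) →
      (∀ x ∈ Icc (0 : ℝ) 1, f x = f 0 + ∫ s in (0 : ℝ)..x, w s i) →
      ∀ᵐ x ∂(volume.restrict (Icc (0 : ℝ) 1)), w x i = 0 := by
    intro i f hf hfx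
    have hint := State.intervalIntegrable_coord w i (right_mem_Icc.2 zero_le_one)
    have hcont : ContinuousOn f (Icc 0 1) := by
      have := (intervalIntegral.continuousOn_primitive_interval' hint left_mem_uIcc).const_add (f 0)
      rw [uIcc_of_le zero_le_one] at this
      exact this.congr hfx
    have hf0 : EqOn f (fun _ => 0) (Icc 0 1) :=
      Measure.eqOn_Icc_of_ae_eq volume zero_ne_one hf hcont continuousOn_const
    refine ae_eq_zero_of_integral_eq_zero zero_le_one hint fun x hx => ?_
    have := hfx x hx
    rw [hf0 hx, hf0 (left_mem_Icc.2 zero_le_one)] at this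
    linarith
  refine State.ext_coord fun i => ?_
  have hi : ∀ᵐ x ∂(volume.restrict (Icc (0 : ℝ) 1)), w x i = 0 := by
    fin_cases i
    · refine key 0 p ?_ h3
      filter_upwards [h1, State.zero_coord] with x hx h0
      rw [hx, h0]
    · refine key 1 q ?_ h4
      filter_upwards [h2, State.zero_coord] with x hx h0
      rw [hx, h0, mul_zero]
  filter_upwards [hi, State.zero_coord] with x hx h0
  rw [hx, h0]

/-- Integration by parts leaves only boundary terms, and the boundary condition turns them into
`(p(1) - q(1))²/4`. -/
theorem OperatorGraph.inner_nonneg {α : ℝ} (hα : 0 < α) {u w : State} (h : OperatorGraph α u w) :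
    0 ≤ inner ℝ (sqrtHam hα w) (sqrtHam hα u) := by
  rw [operatorGraph_iff] at h
  obtain ⟨p, q, ⟨h1, h2⟩, h3, h4, h5, h6⟩ := h
  have h01 : (1 : ℝ) ∈ Icc (0 : ℝ) 1 := right_mem_Icc.2 zero_le_one
  have hw := fun i => State.intervalIntegrable_coord w i h01
  have hcont : ∀ (i : Fin 2) (f : ℝ → ℝ),
      (∀ x ∈ Icc (0 : ℝ) 1, f x = f 0 + ∫ s in (0 : ℝ)..x, w s i) →
      ContinuousOn f (uIcc 0 1) := by
    intro i f hf
    rw [uIcc_of_le zero_le_one]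
    have := (intervalIntegral.continuousOn_primitive_interval' (hw i) left_mem_uIcc).const_add
      (f 0)
    rw [uIcc_of_le zero_le_one] at this
    exact this.congr hf
  have hsq : ∀ (i : Fin 2) (f : ℝ → ℝ),
      (∀ x ∈ Icc (0 : ℝ) 1, f x = f 0 + ∫ s in (0 : ℝ)..x, w s i) →
      ∫ s in (0 : ℝ)..1, w s i * f s = (f 1 ^ 2 - f 0 ^ 2) / 2 := by
    intro i f hf
    have hf' : ∀ x ∈ uIcc (0 : ℝ) 1, f x = f 0 + ∫ s in (0 : ℝ)..x, w s i := by
      rwa [uIcc_of_le zero_le_one]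
    have h := integral_mul_add_mul_eq_sub (hw i) (hw i) hf' hf'
    have h' : ∫ s in (0 : ℝ)..1, (w s i * f s + f s * w s i) =
        2 * ∫ s in (0 : ℝ)..1, w s i * f s := by
      rw [← intervalIntegral.integral_const_mul]
      congr 1
      ext s
      ring
    rw [h'] at h
    linarith
  have key : inner ℝ (sqrtHam hα w) (sqrtHam hα u) =
      ∫ s in (0 : ℝ)..1, (w s 0 * p s + w s 1 * q s) := by
    rw [inner_sqrtHam, intervalIntegral.integral_of_le zero_le_one, ← integral_Icc_eq_integral_Ioc]
    refine integral_congr_ae ?_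
    filter_upwards [h1, h2] with x hp hq
    rw [hp, hq]
    ring
  rw [key, intervalIntegral.integral_add ((hw 0).mul_continuousOn (hcont 0 p h3))
    ((hw 1).mul_continuousOn (hcont 1 q h4)), hsq 0 p h3, hsq 1 q h4, h5, h6]
  nlinarith [sq_nonneg (p 1 - q 1)]

theorem OperatorGraph.exists_resolvent {α : ℝ} (hα : 0 < α) {l : ℝ} (f : State) :
    ∃ u w, OperatorGraph α u w ∧ l • u + w = f := by
  have h01 : (1 : ℝ) ∈ Icc (0 : ℝ) 1 := right_mem_Icc.2 zero_le_one
  let I : ℝ → Fin 2 → ℝ → ℝ := fun k i x => ∫ s in (0 : ℝ)..x, Real.exp (k * s) * f s i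
  let V : ℝ → ℝ → Fin 2 → ℝ → ℝ := fun c k i x => Real.exp (-(k * x)) * (c + I k i x)
  have hV0 : ∀ c k i, V c k i 0 = c := by intro c k i; simp [V, I]
  -- In terms of `v = 𝓗u` the equations are `v₀' + l v₀ = f₀` and `v₁' + αl v₁ = f₁`, with a common
  -- initial value `c`. The boundary condition is one affine equation for `c`, with leading
  -- coefficient `2 + e^{-l} + e^{-αl} > 0`.
  obtain ⟨c, hc⟩ : ∃ c : ℝ, c = -(V c l 0 1 + V c (α * l) 1 1) / 2 := by
    have hpos : (0 : ℝ) < 2 + Real.exp (-(l * 1)) + Real.exp (-(α * l * 1)) := by positivity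
    refine ⟨-(Real.exp (-(l * 1)) * I l 0 1 + Real.exp (-(α * l * 1)) * I (α * l) 1 1) /
      (2 + Real.exp (-(l * 1)) + Real.exp (-(α * l * 1))), ?_⟩
    simp only [V]
    field_simp
    ring
  have hcont : ∀ k i, ContinuousOn (V c k i) (Icc 0 1) := by
    intro k i
    have h1 : IntervalIntegrable (fun s => Real.exp (k * s) * f s i) volume 0 1 :=
      (State.intervalIntegrable_coord f i h01).continuousOn_mul (by fun_prop)
    have h2 := intervalIntegral.continuousOn_primitive_interval' h1 left_mem_uIcc
    rw [uIcc_of_le zero_le_one] at h2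
    exact ContinuousOn.mul (by fun_prop) (h2.const_add c)
  have hprim : ∀ k i, ∀ x ∈ Icc (0 : ℝ) 1,
      V c k i x = c + ∫ s in (0 : ℝ)..x, (f s i - k * V c k i s) := fun k i x hx =>
    exp_mul_primitive_eq (State.intervalIntegrable_coord f i hx) k c
  obtain ⟨u, hu⟩ := State.exists_of_continuousOn ![V c l 0, fun x => α * V c (α * l) 1 x] (by
    intro i
    fin_cases i
    · exact hcont _ _
    · exact (hcont _ _).const_mul α)
  have hu0 := hu 0
  have hu1 := hu 1
  refine ⟨u, f - l • u, ?_, by abel⟩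
  have hw : ∀ᵐ x ∂(volume.restrict (Icc (0 : ℝ) 1)), ∀ i,
      (f - l • u : State) x i = f x i - l * u x i := by
    rw [sub_eq_add_neg, ← neg_smul]
    filter_upwards [State.add_smul_coord f u (-l)] with x hx i
    rw [hx]
    ring
  rw [operatorGraph_iff]
  refine ⟨V c l 0, V c (α * l) 1, ⟨?_, ?_⟩, fun x hx => ?_, fun x hx => ?_, ?_, ?_⟩
  · filter_upwards [hu0] with x hx
    rw [hx]
    rfl
  · filter_upwards [hu1] with x hx
    rw [hx]
    exact (inv_mul_cancel_left₀ hα.ne' _).symm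
  · rw [hV0, hprim _ _ x hx]
    congr 1
    refine State.intervalIntegral_congr hx ?_
    filter_upwards [hw, hu0] with s h1 h2
    rw [h1, h2]
    rfl
  · rw [hV0, hprim _ _ x hx]
    congr 1
    refine State.intervalIntegral_congr hx ?_
    filter_upwards [hw, hu1] with s h1 h2
    rw [h1, h2]
    simp only [Matrix.cons_val_one, Matrix.cons_val_fin_one]
    ring
  · rw [hV0, ← hc]
  · rw [hV0, ← hc]

end OperatorGraph

/-! ### Existence of the contraction semigroup. -/

section Generation

/-- The semigroup obtained from `T` by the change of variables `e`. -/
def C0Semigroup.conj {X Y : Type*} [NormedAddCommGroup X] [NormedSpace ℝ X]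
    [NormedAddCommGroup Y] [NormedSpace ℝ Y] (T : C0Semigroup X) (e : X ≃L[ℝ] Y) :
    C0Semigroup Y where
  op t := (e : X →L[ℝ] Y) ∘L T.op t ∘L (e.symm : Y →L[ℝ] X)
  op_zero := by
    ext y
    simp [T.op_zero]
  op_add s t hs ht := by
    ext y
    simp [T.op_add s t hs ht]
  strong_cont y := by
    have := (e.continuous.tendsto _).comp (T.strong_cont (e.symm y))
    simpa [Function.comp_def] using this

theorem C0Semigroup.generatorGraph_conj {X Y : Type*} [NormedAddCommGroup X] [NormedSpace ℝ X]
    [NormedAddCommGroup Y] [NormedSpace ℝ Y] (T : C0Semigroup X) (e : X ≃L[ℝ] Y) (y z : Y) :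
    (T.conj e).GeneratorGraph y z ↔ T.GeneratorGraph (e.symm y) (e.symm z) := by
  unfold C0Semigroup.GeneratorGraph
  rw [e.symm.toHomeomorph.isInducing.tendsto_nhds_iff]
  refine iff_of_eq (congrArg (fun f => Tendsto f _ _) (funext fun t => ?_))
  simp [C0Semigroup.conj]

/-- Conjugation by `𝓗^{1/2}` turns the energy norm into the `L²` norm, where the Hilbert space form
of Hille–Yosida applies. -/
theorem exists_isExampleSemigroup {α : ℝ} (hα : 0 < α) :
    ∃ T : C0Semigroup State, IsExampleSemigroup α T ∧ IsContractive α T := by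
  let e := sqrtHam hα
  let G : Submodule ℝ (State × State) := (operatorSubmodule α).comap
    ((e.symm : State →L[ℝ] State).prodMap (e.symm : State →L[ℝ] State) :
      State × State →L[ℝ] State × State).toLinearMap
  have hG : ∀ y z, (y, z) ∈ G ↔ OperatorGraph α (e.symm y) (e.symm z) := fun y z => Iff.rfl
  obtain ⟨T, hT, hTG⟩ := exists_contraction_semigroup G
    (by
      rintro ⟨y, z⟩ h
      rw [hG] at h
      simpa [e] using h.inner_nonneg hα)
    (by
      intro l hl f
      obtain ⟨u, w, h, huw⟩ := OperatorGraph.exists_resolvent hα (l := l) (e.symm f)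
      refine ⟨e u, e w, ?_, ?_⟩
      · rw [hG]
        simpa using h
      · rw [← map_smul, ← map_add, huw, e.apply_symm_apply])
    (by
      intro w h
      rw [hG, map_zero] at h
      simpa using h.eq_zero)
  refine ⟨T.conj e.symm, fun u w => ?_, fun t ht u => ?_⟩
  · rw [C0Semigroup.generatorGraph_conj, hTG, hG]
    simp
  · rw [energyNorm_eq hα, energyNorm_eq hα]
    simpa [C0Semigroup.conj, e] using hT t ht (e u)

end Generation

/-! ### Approximating `α` by ratios of odd integers. -/

section Diophantine

theorem mul_odd_ne_odd {α : ℝ} (hirr : Irrational α) (p q : ℤ) :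
    α * (2 * p + 1) ≠ 2 * q + 1 := by
  intro h
  have hp : (2 * p + 1 : ℝ) ≠ 0 := by exact_mod_cast (by omega : 2 * p + 1 ≠ 0)
  refine hirr ⟨(2 * q + 1) / (2 * p + 1), ?_⟩
  push_cast
  rw [← h, mul_div_assoc, div_self hp, mul_one]

/-- The subgroup `2αℤ + 2ℤ` is dense because `α` is irrational; approximating `1 - α` by `2αm + 2n`
produces the odd integers `2m + 1` and `-2n + 1`. -/
theorem exists_odd_mul_sub_odd_lt {α : ℝ} (hirr : Irrational α) {ε : ℝ} (hε : 0 < ε) :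
    ∃ p q : ℤ, |2 * q + 1 - α * (2 * p + 1)| < ε := by
  have hd : Dense (AddSubgroup.closure {2 * α, 2} : Set ℝ) := by
    rw [dense_addSubgroupClosure_pair_iff]
    rwa [mul_div_cancel_left₀ _ (two_ne_zero' ℝ)]
  obtain ⟨x, hx, hxε⟩ := hd.exists_dist_lt (1 - α) hε
  rw [SetLike.mem_coe, AddSubgroup.mem_closure_pair] at hx
  obtain ⟨m, n, rfl⟩ := hx
  refine ⟨m, -n, ?_⟩
  rw [Real.dist_eq] at hxε
  convert hxε using 2
  simp only [zsmul_eq_mul]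
  push_cast
  ring

end Diophantine

/-! ### Orbits of bounded semigroups along moving vectors. -/

section Orbits

variable {X : Type*} [NormedAddCommGroup X] [NormedSpace ℝ X] (T : C0Semigroup X)

theorem C0Semigroup.tendsto_zero (y : X) :
    Tendsto (fun t => T.op t y) (𝓝[≥] 0) (𝓝 y) := by
  rw [← Ioi_insert, nhdsWithin_insert, tendsto_sup]
  refine ⟨?_, T.strong_cont y⟩
  rw [tendsto_pure_left]
  intro s hs
  rw [T.op_zero]
  exact mem_of_mem_nhds hs

variable {T} {C : ℝ}

theorem C0Semigroup.dist_op_le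
    (hC : ∀ t : ℝ, 0 ≤ t → ∀ u, ‖T.op t u‖ ≤ C * ‖u‖)
    {r s : ℝ} (hr : 0 ≤ r) (hs : 0 ≤ s) (y : X) :
    ‖T.op r y - T.op s y‖ ≤ C * ‖T.op |r - s| y - y‖ := by
  wlog h : s ≤ r generalizing r s
  · rw [norm_sub_rev, abs_sub_comm]
    exact this hs hr (le_of_not_ge h)
  have h1 : T.op r y = T.op s (T.op |r - s| y) := by
    rw [← ContinuousLinearMap.comp_apply, ← T.op_add s _ hs (abs_nonneg _),
      abs_of_nonneg (sub_nonneg.2 h), add_sub_cancel]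
  rw [h1, ← map_sub]
  exact hC s hs _

theorem C0Semigroup.continuousOn_op_apply
    (hC : ∀ t : ℝ, 0 ≤ t → ∀ u, ‖T.op t u‖ ≤ C * ‖u‖)
    {c : ℝ → X} (hc : Continuous c) :
    ContinuousOn (fun s => T.op s (c s)) (Ici 0) := by
  intro s hs
  have hs : 0 ≤ s := hs
  rw [ContinuousWithinAt, tendsto_iff_norm_sub_tendsto_zero]
  have h1 : Tendsto (fun r => C * ‖c r - c s‖ + C * ‖T.op |r - s| (c s) - c s‖) (𝓝[Ici 0] s)
      (𝓝 0) := by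
    have h2 : Tendsto (fun r => ‖c r - c s‖) (𝓝[Ici 0] s) (𝓝 0) := by
      have := ((hc.tendsto s).sub_const (c s)).norm.mono_left
        (nhdsWithin_le_nhds (s := Ici (0 : ℝ)))
      simpa using this
    have h3 : Tendsto (fun r : ℝ => |r - s|) (𝓝[Ici 0] s) (𝓝[≥] 0) := by
      refine tendsto_nhdsWithin_iff.2 ⟨?_, Eventually.of_forall fun r => abs_nonneg (r - s)⟩
      have : Continuous fun r : ℝ => |r - s| := by fun_prop
      have := (this.tendsto s).mono_left (nhdsWithin_le_nhds (s := Ici (0 : ℝ)))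
      simpa using this
    have h4 := (((T.tendsto_zero (c s)).comp h3).sub_const (c s)).norm
    rw [sub_self, norm_zero] at h4
    simpa using (h2.const_mul C).add (h4.const_mul C)
  refine squeeze_zero' (Eventually.of_forall fun r => norm_nonneg _) ?_ h1
  filter_upwards [self_mem_nhdsWithin] with r hr
  have hr : 0 ≤ r := hr
  have h2 : T.op r (c r) - T.op s (c s) = T.op r (c r - c s) + (T.op r (c s) - T.op s (c s)) := by
    rw [map_sub]; abel
  rw [h2]
  exact (norm_add_le _ _).trans (add_le_add (hC r hr _) (C0Semigroup.dist_op_le hC hr hs _))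

/-- Factor `T(r)c(r) = T(s)T(r-s)c(r)` and differentiate inside `T(s)`. Only a right derivative
results, which suffices for the mean value inequality. -/
theorem C0Semigroup.hasDerivWithinAt_op_apply
    (hC : ∀ t : ℝ, 0 ≤ t → ∀ u, ‖T.op t u‖ ≤ C * ‖u‖)
    {c : ℝ → X} {s : ℝ} {c' g : X} (hs : 0 ≤ s)
    (hc : HasDerivAt c c' s) (hg : T.GeneratorGraph (c s) g) :
    HasDerivWithinAt (fun s => T.op s (c s)) (T.op s (c' + g)) (Ici s) s := by
  rw [← hasDerivWithinAt_Ioi_iff_Ici,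
    hasDerivWithinAt_iff_tendsto_slope' (notMem_Ioi.2 le_rfl)]
  have hsub : Tendsto (fun r : ℝ => r - s) (𝓝[>] s) (𝓝[>] 0) := by
    refine tendsto_nhdsWithin_iff.2 ⟨?_, ?_⟩
    · have : Continuous fun r : ℝ => r - s := by fun_prop
      have := (this.tendsto s).mono_left (nhdsWithin_le_nhds (s := Ioi s))
      simpa using this
    · filter_upwards [self_mem_nhdsWithin] with r hr
      exact sub_pos.2 (mem_Ioi.1 hr)
  have h1 : Tendsto (fun r => (r - s)⁻¹ • (c r - c s)) (𝓝[>] s) (𝓝 c') := by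
    have := (hasDerivWithinAt_iff_tendsto_slope' (notMem_Ioi.2 le_rfl)).1
      (hc.hasDerivWithinAt (s := Ioi s))
    simpa [slope_fun_def] using this
  have h2 : Tendsto (fun r => T.op (r - s) ((r - s)⁻¹ • (c r - c s))) (𝓝[>] s) (𝓝 c') := by
    have h3 : Tendsto (fun r => T.op (r - s) ((r - s)⁻¹ • (c r - c s) - c')) (𝓝[>] s) (𝓝 0) := by
      have h4 := ((h1.sub_const c').norm).const_mul C
      rw [sub_self, norm_zero, mul_zero] at h4
      refine squeeze_zero_norm' ?_ h4
      filter_upwards [self_mem_nhdsWithin] with r hr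
      exact hC _ (sub_pos.2 (mem_Ioi.1 hr)).le _
    have := h3.add ((T.strong_cont c').comp hsub)
    simpa [Function.comp_def] using this
  have h3 := ((T.op s).continuous.tendsto _).comp (h2.add (hg.comp hsub))
  refine h3.congr' ?_
  filter_upwards [self_mem_nhdsWithin] with r hr
  have hr : s < r := hr
  have h4 : T.op r (c r) = T.op s (T.op (r - s) (c r)) := by
    rw [← ContinuousLinearMap.comp_apply, ← T.op_add s _ hs (sub_nonneg.2 hr.le), add_sub_cancel]
  simp only [Function.comp_apply, slope_fun_def, vsub_eq_sub, h4, map_smul, map_add, map_sub,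
    ← smul_add]
  congr 1
  abel

/-- An approximate eigenvector `a + i b` of the generator for the eigenvalue `-i k`
is almost an eigenvector of the semigroup. -/
theorem C0Semigroup.norm_rotation_sub_le
    (hC : ∀ t : ℝ, 0 ≤ t → ∀ u, ‖T.op t u‖ ≤ C * ‖u‖)
    (hC0 : 0 ≤ C) {a b g h : X} (ha : T.GeneratorGraph a g)
    (hb : T.GeneratorGraph b h) (k : ℝ) {t : ℝ} (ht : 0 ≤ t) :
    ‖T.op t (Real.cos (k * t) • a - Real.sin (k * t) • b) - a‖ ≤
      C * (‖g - k • b‖ + ‖h + k • a‖) * t := by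
  -- This is the real part of `e^{iks}(a + ib)`. If `a + ib` were an exact eigenvector for `-ik`,
  -- then `T(s)c(s)` would be constant; its derivative measures the defect.
  let c : ℝ → X := fun s => Real.cos (k * s) • a - Real.sin (k * s) • b
  have hgen : ∀ s, T.GeneratorGraph (c s) (Real.cos (k * s) • g - Real.sin (k * s) • h) := by
    intro s
    have := (ha.const_smul (Real.cos (k * s))).sub (hb.const_smul (Real.sin (k * s)))
    refine this.congr fun r => ?_
    simp only [c, map_sub, map_smul]
    module
  have hder : ∀ s, HasDerivAt c
      (Real.cos (k * s) • (-(k • b)) - Real.sin (k * s) • (k • a)) s := by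
    intro s
    have h0 : HasDerivAt (fun s : ℝ => k * s) k s := by
      simpa using (hasDerivAt_id s).const_mul k
    have := (h0.cos.smul_const a).sub (h0.sin.smul_const b)
    refine this.congr_deriv ?_
    module
  have key := norm_image_sub_le_of_norm_deriv_right_le_segment (a := 0) (b := t)
    (f := fun s => T.op s (c s)) (C := C * (‖g - k • b‖ + ‖h + k • a‖))
    ((C0Semigroup.continuousOn_op_apply hC
      (by fun_prop)).mono fun x hx => hx.1)
    (fun s hs => C0Semigroup.hasDerivWithinAt_op_apply hC hs.1 (hder s) (hgen s))
    (fun s hs => by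
      refine (hC s hs.1 _).trans (mul_le_mul_of_nonneg_left ?_ hC0)
      have h1 : Real.cos (k * s) • (-(k • b)) - Real.sin (k * s) • (k • a) +
          (Real.cos (k * s) • g - Real.sin (k * s) • h) =
          Real.cos (k * s) • (g - k • b) - Real.sin (k * s) • (h + k • a) := by module
      rw [h1]
      refine (norm_sub_le _ _).trans (add_le_add ?_ ?_)
      · rw [norm_smul]
        exact mul_le_of_le_one_left (norm_nonneg _) (Real.abs_cos_le_one _)
      · rw [norm_smul]
        exact mul_le_of_le_one_left (norm_nonneg _) (Real.abs_sin_le_one _))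
    t (right_mem_Icc.2 ht)
  simpa [c, T.op_zero] using key

end Orbits

/-! ### Almost harmonic modes and failure of exponential stability. -/

section Modes

theorem State.norm_le_of_coord {u : State} {B : ℝ} (hB : 0 ≤ B)
    (h : ∀ i, ∀ᵐ x ∂(volume.restrict (Icc (0 : ℝ) 1)), |u x i| ≤ B) : ‖u‖ ≤ 2 * B := by
  have h1 := Lp.norm_le_of_ae_bound (f := u) (C := 2 * B) (by positivity) (by
    filter_upwards [ae_all_iff.2 h] with x hx
    rw [EuclideanSpace.norm_eq, Fin.sum_univ_two]
    refine Real.sqrt_le_iff.2 ⟨by positivity, ?_⟩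
    have h0 := pow_le_pow_left₀ (abs_nonneg _) (hx 0) 2
    have h1 := pow_le_pow_left₀ (abs_nonneg _) (hx 1) 2
    simp only [Real.norm_eq_abs]
    nlinarith)
  simpa [measureUnivNNReal] using h1

theorem integral_deriv_cos (k x : ℝ) :
    Real.cos (k * x) = Real.cos (k * 0) + ∫ s in (0 : ℝ)..x, -k * Real.sin (k * s) := by
  rw [intervalIntegral.integral_eq_sub_of_hasDerivAt (f := fun s => Real.cos (k * s))
    (fun s _ => ?_) (Continuous.intervalIntegrable (by fun_prop) _ _)]
  · ring
  · have := ((hasDerivAt_id s).const_mul k).cos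
    simpa [mul_comm] using this

theorem integral_deriv_sin (k x : ℝ) :
    Real.sin (k * x) = Real.sin (k * 0) + ∫ s in (0 : ℝ)..x, k * Real.cos (k * s) := by
  rw [intervalIntegral.integral_eq_sub_of_hasDerivAt (f := fun s => Real.sin (k * s))
    (fun s _ => ?_) (Continuous.intervalIntegrable (by fun_prop) _ _)]
  · ring
  · have := ((hasDerivAt_id s).const_mul k).sin
    simpa [mul_comm] using this

theorem cos_odd_mul_pi (p : ℤ) : Real.cos (Real.pi * (2 * p + 1)) = -1 := by
  rw [Real.cos_eq_neg_one_iff]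
  exact ⟨p, by ring⟩

theorem sin_odd_mul_pi (p : ℤ) : Real.sin (Real.pi * (2 * p + 1)) = 0 := by
  rw [Real.sin_eq_zero_iff]
  exact ⟨2 * p + 1, by push_cast; ring⟩

theorem integral_cos_sq_mul {k : ℝ} (hk : k ≠ 0) (hs : Real.sin k = 0) :
    ∫ x in (0 : ℝ)..1, Real.cos (k * x) ^ 2 = 1 / 2 := by
  rw [intervalIntegral.integral_comp_mul_left (fun x => Real.cos x ^ 2) hk, integral_cos_sq]
  simp [hs]
  field_simp

/-- Almost time-harmonic solutions: both `a` and `b` satisfy the boundary condition, and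
`𝓐 (a + i b) = i k (a + i b) + O(δ)` with `δ = l - α k`. -/
theorem exists_modes {α : ℝ} (hα : 0 < α) (p q : ℤ) :
    ∃ a b c d : State,
      OperatorGraph α a (-((Real.pi * (2 * p + 1)) • b +
        (Real.pi * (2 * q + 1 - α * (2 * p + 1))) • d)) ∧
      OperatorGraph α b ((Real.pi * (2 * p + 1)) • a +
        (Real.pi * (2 * q + 1 - α * (2 * p + 1))) • c) ∧
      1 / 2 ≤ ‖sqrtHam hα a‖ ∧ ‖a‖ ≤ 2 * (1 + α) ∧ ‖b‖ ≤ 2 * (1 + α) ∧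
      ‖c‖ ≤ 2 * (1 + α) ∧ ‖d‖ ≤ 2 * (1 + α) := by
  set k : ℝ := Real.pi * (2 * p + 1) with hk
  set l : ℝ := Real.pi * (2 * q + 1) with hl
  have hk0 : k ≠ 0 := mul_ne_zero Real.pi_ne_zero
    (by exact_mod_cast (by omega : 2 * p + 1 ≠ 0))
  have hδ : Real.pi * (2 * q + 1 - α * (2 * p + 1)) = l - α * k := by rw [hk, hl]; ring
  rw [hδ]
  have hck : Real.cos k = -1 := cos_odd_mul_pi p
  have hcl : Real.cos l = -1 := cos_odd_mul_pi q
  have hsk : Real.sin k = 0 := sin_odd_mul_pi p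
  have hsl : Real.sin l = 0 := sin_odd_mul_pi q
  have hst : ∀ f g : ℝ → ℝ, Continuous f → Continuous g → (∀ x, |f x| ≤ 1 + α) →
      (∀ x, |g x| ≤ 1 + α) → ∃ u : State, (∀ᵐ x ∂(volume.restrict (Icc (0 : ℝ) 1)),
        u x 0 = f x ∧ u x 1 = g x) ∧ ‖u‖ ≤ 2 * (1 + α) := by
    intro f g hf hg hfb hgb
    obtain ⟨u, hu⟩ := State.exists_of_continuousOn ![f, g] (by
      intro i
      fin_cases i
      · exact hf.continuousOn
      · exact hg.continuousOn)
    refine ⟨u, ?_, State.norm_le_of_coord (by positivity) fun i => ?_⟩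
    · filter_upwards [hu 0, hu 1] with x h0 h1
      exact ⟨h0, h1⟩
    · filter_upwards [hu i] with x hx
      rw [hx]
      fin_cases i
      · exact hfb x
      · exact hgb x
  have hb1 : ∀ y : ℝ, |y| ≤ 1 → |y| ≤ 1 + α := fun y hy => by linarith
  have hbα : ∀ y : ℝ, |y| ≤ 1 → |α * y| ≤ 1 + α := fun y hy => by
    rw [abs_mul, abs_of_pos hα]
    nlinarith
  have hb0 : |(0 : ℝ)| ≤ 1 + α := by rw [abs_zero]; positivity
  -- `a + ib = (e^{ikx}, αe^{ilx})` and `c + id = (0, e^{ilx})`, so that `𝓐(a + ib) = ik(a + ib) +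
  -- i(l - αk)(c + id)`.
  obtain ⟨a, ha, ha'⟩ := hst (fun x => Real.cos (k * x)) (fun x => α * Real.cos (l * x))
    (by fun_prop) (by fun_prop) (fun x => hb1 _ (Real.abs_cos_le_one _))
    (fun x => hbα _ (Real.abs_cos_le_one _))
  obtain ⟨b, hb, hb'⟩ := hst (fun x => Real.sin (k * x)) (fun x => α * Real.sin (l * x))
    (by fun_prop) (by fun_prop) (fun x => hb1 _ (Real.abs_sin_le_one _))
    (fun x => hbα _ (Real.abs_sin_le_one _))
  obtain ⟨c, hc, hc'⟩ := hst (fun x => 0) (fun x => Real.cos (l * x))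
    (by fun_prop) (by fun_prop) (fun x => hb0) (fun x => hb1 _ (Real.abs_cos_le_one _))
  obtain ⟨d, hd, hd'⟩ := hst (fun x => 0) (fun x => Real.sin (l * x))
    (by fun_prop) (by fun_prop) (fun x => hb0) (fun x => hb1 _ (Real.abs_sin_le_one _))
  have hcoord : ∀ (u w : State) (r s : ℝ), ∀ᵐ x ∂(volume.restrict (Icc (0 : ℝ) 1)), ∀ i,
      (r • u + s • w : State) x i = r * u x i + s * w x i := by
    intro u w r s
    filter_upwards [State.add_smul_coord (r • u) w s, State.add_smul_coord 0 u r,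
      State.zero_coord] with x h1 h2 h3 i
    rw [h1, ← zero_add (r • u), h2, h3, zero_add]
  refine ⟨a, b, c, d, ?_, ?_, ?_, ha', hb', hc', hd'⟩
  · rw [operatorGraph_iff]
    have hw : ∀ᵐ x ∂(volume.restrict (Icc (0 : ℝ) 1)),
        (-(k • b + (l - α * k) • d) : State) x 0 = -k * Real.sin (k * x) ∧
        (-(k • b + (l - α * k) • d) : State) x 1 = -l * Real.sin (l * x) := by
      have : -(k • b + (l - α * k) • d) = (-k) • b + (-(l - α * k)) • d := by module
      rw [this]
      filter_upwards [hcoord b d (-k) (-(l - α * k)), hb, hd] with x h1 h2 h3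
      rw [h1, h1, h2.1, h2.2, h3.1, h3.2]
      constructor <;> ring
    refine ⟨fun x => Real.cos (k * x), fun x => Real.cos (l * x), ⟨?_, ?_⟩, fun x hx => ?_,
      fun x hx => ?_, ?_, ?_⟩
    · filter_upwards [ha] with x h
      rw [h.1]
    · filter_upwards [ha] with x h
      rw [h.2, inv_mul_cancel_left₀ hα.ne']
    · rw [State.intervalIntegral_congr hx (hw.mono fun s h => h.1)]
      exact integral_deriv_cos k x
    · rw [State.intervalIntegral_congr hx (hw.mono fun s h => h.2)]
      exact integral_deriv_cos l x
    · norm_num [hck, hcl]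
    · norm_num [hck, hcl]
  · rw [operatorGraph_iff]
    have hw : ∀ᵐ x ∂(volume.restrict (Icc (0 : ℝ) 1)),
        (k • a + (l - α * k) • c : State) x 0 = k * Real.cos (k * x) ∧
        (k • a + (l - α * k) • c : State) x 1 = l * Real.cos (l * x) := by
      filter_upwards [hcoord a c k (l - α * k), ha, hc] with x h1 h2 h3
      rw [h1, h1, h2.1, h2.2, h3.1, h3.2]
      constructor <;> ring
    refine ⟨fun x => Real.sin (k * x), fun x => Real.sin (l * x), ⟨?_, ?_⟩, fun x hx => ?_,
      fun x hx => ?_, ?_, ?_⟩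
    · filter_upwards [hb] with x h
      rw [h.1]
    · filter_upwards [hb] with x h
      rw [h.2, inv_mul_cancel_left₀ hα.ne']
    · rw [State.intervalIntegral_congr hx (hw.mono fun s h => h.1)]
      exact integral_deriv_sin k x
    · rw [State.intervalIntegral_congr hx (hw.mono fun s h => h.2)]
      exact integral_deriv_sin l x
    · norm_num [hsk, hsl]
    · norm_num [hsk, hsl]
  · have h1 : 1 / 2 ≤ ‖sqrtHam hα a‖ ^ 2 := by
      rw [← real_inner_self_eq_norm_sq, inner_sqrtHam, ← integral_cos_sq_mul hk0 hsk,
        intervalIntegral.integral_of_le zero_le_one, ← integral_Icc_eq_integral_Ioc]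
      refine integral_mono_ae ?_ ?_ ?_
      · exact Continuous.integrableOn_Icc (by fun_prop)
      · have h2 := (State.memLp_coord a 0).integrable_mul (State.memLp_coord a 0)
        have h3 := (State.memLp_coord a 1).integrable_mul (State.memLp_coord a 1)
        exact h2.add (h3.const_mul _)
      · filter_upwards [ha] with x h
        rw [h.1, sq]
        have : 0 ≤ α⁻¹ * (a x 1 * a x 1) := mul_nonneg (by positivity) (mul_self_nonneg _)
        linarith
    nlinarith [norm_nonneg (sqrtHam hα a)]

/-- The modes are bounded above and below uniformly in `p` and `q`, while their defect can be made
arbitrarily small; decay would force the fixed lower bound `1/2` under a quantity tending to `0`. -/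
theorem not_isExponentiallyStable {α : ℝ} (hα : 0 < α) (hirr : Irrational α)
    {T : C0Semigroup State} (hT : IsExampleSemigroup α T) : ¬ IsExponentiallyStable α T := by
  rintro ⟨K, ω, hω, hK⟩
  let e := sqrtHam hα
  let S := T.conj e
  have hS : ∀ t : ℝ, 0 ≤ t → ∀ u, ‖S.op t u‖ ≤ |K| * Real.exp (-(ω * t)) * ‖u‖ := by
    intro t ht u
    have := hK t ht (e.symm u)
    rw [energyNorm_eq hα, energyNorm_eq hα] at this
    have h2 : ‖S.op t u‖ ≤ K * Real.exp (-(ω * t)) * ‖u‖ := by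
      simpa [S, C0Semigroup.conj, e] using this
    refine h2.trans ?_
    gcongr
    exact le_abs_self K
  have hC : ∀ t : ℝ, 0 ≤ t → ∀ u, ‖S.op t u‖ ≤ |K| * ‖u‖ := by
    intro t ht u
    refine (hS t ht u).trans ?_
    gcongr
    exact mul_le_of_le_one_right (abs_nonneg _) (Real.exp_le_one_iff.2 (by nlinarith))
  have hgen : ∀ u w, OperatorGraph α u w → S.GeneratorGraph (e u) (-(e w)) := by
    intro u w h
    rw [C0Semigroup.generatorGraph_conj, hT]
    simpa using h
  let M : ℝ := ‖(e : State →L[ℝ] State)‖ * (2 * (1 + α))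
  have hM : ∀ u : State, ‖u‖ ≤ 2 * (1 + α) → ‖e u‖ ≤ M := fun u hu =>
    ((e : State →L[ℝ] State).le_opNorm u).trans (mul_le_mul_of_nonneg_left hu (norm_nonneg _))
  have hM0 : 0 ≤ M := by positivity
  have hmain : ∀ t : ℝ, 0 ≤ t → 1 / 2 ≤ |K| * Real.exp (-(ω * t)) * (2 * M) := by
    intro t ht
    refine le_of_forall_pos_le_add fun ε hε => ?_
    -- The mode is chosen after `t` and `ε`, so that the drift accumulated up to time `t` is at most
    -- `ε`. The summand `1` covers the case where the product vanishes.
    have hden : 0 < Real.pi * (|K| * (2 * M) * t + 1) := by positivity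
    obtain ⟨p, q, hpq⟩ := exists_odd_mul_sub_odd_lt hirr (div_pos hε hden)
    obtain ⟨a, b, c, d, ha, hb, ha1, haM, hbM, hcM, hdM⟩ := exists_modes hα p q
    set k : ℝ := Real.pi * (2 * p + 1)
    set δ : ℝ := Real.pi * (2 * q + 1 - α * (2 * p + 1)) with hδ
    have h1 := C0Semigroup.norm_rotation_sub_le hC (abs_nonneg K) (hgen _ _ ha) (hgen _ _ hb) k ht
    have h2 : -(e (-(k • b + δ • d))) - k • e b = δ • e d := by
      simp only [map_neg, map_add, map_smul]
      module
    have h3 : -(e (k • a + δ • c)) + k • e a = -(δ • e c) := by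
      simp only [map_add, map_smul]
      module
    rw [h2, h3, norm_neg, norm_smul, norm_smul, Real.norm_eq_abs] at h1
    have h4 : ‖Real.cos (k * t) • e a - Real.sin (k * t) • e b‖ ≤ 2 * M := by
      refine (norm_sub_le _ _).trans ?_
      rw [norm_smul, norm_smul, two_mul]
      refine add_le_add ?_ ?_
      · exact (mul_le_of_le_one_left (norm_nonneg _) (Real.abs_cos_le_one _)).trans (hM a haM)
      · exact (mul_le_of_le_one_left (norm_nonneg _) (Real.abs_sin_le_one _)).trans (hM b hbM)
    have h5 := (hS t ht (Real.cos (k * t) • e a - Real.sin (k * t) • e b)).trans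
      (mul_le_mul_of_nonneg_left h4 (by positivity))
    have h6 := norm_sub_norm_le (e a) (S.op t (Real.cos (k * t) • e a - Real.sin (k * t) • e b))
    rw [norm_sub_rev] at h6
    have hδε : |δ| * (|K| * (2 * M) * t) ≤ ε := by
      rw [lt_div_iff₀ hden] at hpq
      rw [hδ, abs_mul, abs_of_pos Real.pi_pos]
      have : 0 ≤ Real.pi * |2 * q + 1 - α * (2 * p + 1)| := by positivity
      nlinarith
    have h7 : |K| * (|δ| * ‖e d‖ + |δ| * ‖e c‖) * t ≤ |δ| * (|K| * (2 * M) * t) := by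
      calc |K| * (|δ| * ‖e d‖ + |δ| * ‖e c‖) * t ≤ |K| * (|δ| * M + |δ| * M) * t := by
            gcongr
            · exact hM d hdM
            · exact hM c hcM
        _ = _ := by ring
    change 1 / 2 ≤ ‖e a‖ at ha1
    linarith
  have hlim : Tendsto (fun t : ℝ => |K| * Real.exp (-(ω * t)) * (2 * M)) atTop (𝓝 0) := by
    have h1 : Tendsto (fun t : ℝ => Real.exp (-(ω * t))) atTop (𝓝 0) :=
      Real.tendsto_exp_neg_atTop_nhds_zero.comp (tendsto_id.const_mul_atTop hω)
    simpa using (h1.const_mul |K|).mul_const (2 * M)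
  have := ge_of_tendsto hlim ((eventually_ge_atTop 0).mono hmain)
  norm_num at this

end Modes

/-! ### The characteristic matrix and the growth of its inverse. -/

section CharMatrix

theorem charMatrix_eq (α t : ℝ) :
    charMatrix α t = !![Complex.exp (Complex.I * t) / 2 + 1, Complex.exp (Complex.I * (α * t)) / 2;
      Complex.exp (Complex.I * t) / 2, Complex.exp (Complex.I * (α * t)) / 2 + 1] := by
  ext i j
  fin_cases i <;> fin_cases j <;> simp [charMatrix, bdM, Matrix.mul_diagonal] <;> ring

/-- A zero determinant means `e^{it} + e^{iαt} = -2`; real parts force both cosines to be `-1`,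
making `α` a ratio of odd integers. -/
theorem isUnit_charMatrix {α : ℝ} (hirr : Irrational α) (t : ℝ) : IsUnit (charMatrix α t) := by
  rw [Matrix.isUnit_iff_isUnit_det, isUnit_iff_ne_zero, charMatrix_eq, Matrix.det_fin_two_of]
  intro h
  have h1 : Complex.exp (t * Complex.I) + Complex.exp ((α * t : ℝ) * Complex.I) = -2 := by
    rw [mul_comm _ Complex.I, mul_comm _ Complex.I]
    push_cast
    linear_combination 2 * h
  have h2 := congrArg Complex.re h1
  rw [Complex.add_re, Complex.exp_ofReal_mul_I_re, Complex.exp_ofReal_mul_I_re] at h2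
  norm_num at h2
  have h3 : Real.cos t = -1 := by linarith [Real.neg_one_le_cos t, Real.neg_one_le_cos (α * t)]
  have h4 : Real.cos (α * t) = -1 := by linarith
  obtain ⟨p, hp⟩ := Real.cos_eq_neg_one_iff.1 h3
  obtain ⟨q, hq⟩ := Real.cos_eq_neg_one_iff.1 h4
  refine mul_odd_ne_odd hirr p q (mul_left_cancel₀ Real.pi_ne_zero ?_)
  rw [← hp] at hq
  linear_combination -hq

/-- Continuity of the inverse on a compact interval. Without boundedness the real `sSup` in `growth`
would take its default value `0` and dominate nothing. -/
theorem bddAbove_norm_inv_charMatrix {α : ℝ} (hirr : Irrational α) (η : ℝ) :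
    BddAbove ((fun t : ℝ => ‖(charMatrix α t)⁻¹‖) '' Icc (-η) η) := by
  refine isCompact_Icc.bddAbove_image (Continuous.continuousOn ?_)
  refine Continuous.norm (continuous_iff_continuousAt.2 fun t => ?_)
  have h1 : Continuous (charMatrix α) := by
    have : charMatrix α = fun t => _ := funext (charMatrix_eq α)
    rw [this]
    refine continuous_matrix fun i j => ?_
    fin_cases i <;> fin_cases j <;> simp <;> fun_prop
  simp only [Matrix.nonsing_inv_eq_ringInverse]
  obtain ⟨u, hu⟩ := isUnit_charMatrix hirr t
  refine ContinuousAt.comp (f := charMatrix α) (g := Ring.inverse) ?_ h1.continuousAt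
  rw [← hu]
  exact NormedRing.inverse_continuousAt u

/-- At `t = π(2p+1)` one has `e^{it} = -1` and `e^{iαt} = -z` with `z = e^{-iπδ}`. Hence `(1,1)` is
an eigenvector for `(1 - z)/2`, which has modulus at most `π|δ|`. -/
theorem inv_le_norm_inv_charMatrix {α : ℝ} (hirr : Irrational α) (p q : ℤ) :
    (Real.pi * |2 * q + 1 - α * (2 * p + 1)|)⁻¹ ≤
      ‖(charMatrix α (Real.pi * (2 * p + 1)))⁻¹‖ := by
  set t : ℝ := Real.pi * (2 * p + 1) with ht
  set δ : ℝ := 2 * q + 1 - α * (2 * p + 1) with hδ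
  have hδ0 : δ ≠ 0 := sub_ne_zero.2 (mul_odd_ne_odd hirr p q).symm
  have h1 : Complex.exp (Complex.I * t) = -1 := by
    rw [mul_comm, Complex.exp_mul_I, ← Complex.ofReal_cos, ← Complex.ofReal_sin, ht,
      cos_odd_mul_pi, sin_odd_mul_pi]
    simp
  set z : ℂ := Complex.exp (Complex.I * ((-(Real.pi * δ) : ℝ) : ℂ)) with hz
  have h2 : Complex.exp (Complex.I * (α * t)) = -z := by
    have h3 : Complex.exp (Complex.I * ((Real.pi * (2 * q + 1) : ℝ) : ℂ)) = -1 := by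
      rw [mul_comm, Complex.exp_mul_I, ← Complex.ofReal_cos, ← Complex.ofReal_sin,
        cos_odd_mul_pi, sin_odd_mul_pi]
      simp
    rw [hz, neg_eq_neg_one_mul, ← h3, ← Complex.exp_add, ← mul_add, ← Complex.ofReal_add,
      ← Complex.ofReal_mul]
    congr 4
    rw [ht, hδ]
    ring
  have hzn : ‖(1 - z) / 2‖ ≤ Real.pi * |δ| := by
    have h3 : ‖z - 1‖ ≤ ‖-(Real.pi * δ)‖ := Real.norm_exp_I_mul_ofReal_sub_one_le
    rw [norm_neg, norm_mul, Real.norm_of_nonneg Real.pi_pos.le, Real.norm_eq_abs] at h3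
    rw [norm_div, norm_sub_rev]
    have : ‖(2 : ℂ)‖ = 2 := by simp
    rw [this]
    linarith [norm_nonneg (z - 1)]
  let v : EuclideanSpace ℂ (Fin 2) := WithLp.toLp 2 ![1, 1]
  have hv : v ≠ 0 := fun h => by
    have := congrArg (fun w : EuclideanSpace ℂ (Fin 2) => w 0) h
    simp [v] at this
  have hTv : (charMatrix α t).mulVec v = ((1 - z) / 2) • v.ofLp := by
    rw [charMatrix_eq, h1, h2]
    ext i
    fin_cases i <;> simp [v, Matrix.mulVec, dotProduct, Fin.sum_univ_two] <;> ring
  have hdet := (Matrix.isUnit_iff_isUnit_det _).1 (isUnit_charMatrix hirr t)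
  have hvinv : v.ofLp = ((1 - z) / 2) • (charMatrix α t)⁻¹.mulVec v := by
    rw [← Matrix.mulVec_smul, ← hTv, Matrix.mulVec_mulVec, Matrix.nonsing_inv_mul _ hdet,
      Matrix.one_mulVec]
  have hnorm : ‖v‖ ≤ ‖(1 - z) / 2‖ * (‖(charMatrix α t)⁻¹‖ * ‖v‖) := by
    have h3 := Matrix.l2_opNorm_mulVec (charMatrix α t)⁻¹ v
    have h4 : v = ((1 - z) / 2) • (WithLp.toLp 2 ((charMatrix α t)⁻¹.mulVec v) :
        EuclideanSpace ℂ (Fin 2)) := by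
      ext i
      exact congrFun hvinv i
    calc ‖v‖ = ‖(1 - z) / 2‖ * ‖(WithLp.toLp 2 ((charMatrix α t)⁻¹.mulVec v) :
        EuclideanSpace ℂ (Fin 2))‖ := by rw [← norm_smul, ← h4]
      _ ≤ _ := by gcongr; exact h3
  have hvpos := norm_pos_iff.2 hv
  rw [← mul_assoc] at hnorm
  have h5 : 1 ≤ ‖(1 - z) / 2‖ * ‖(charMatrix α t)⁻¹‖ := by
    by_contra hlt
    push Not at hlt
    nlinarith
  rw [inv_le_iff_one_le_mul₀' (by positivity)]
  exact h5.trans (by gcongr)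

theorem not_bddAbove_growth {α : ℝ} (hirr : Irrational α) : ¬ BddAbove (growth α '' Ici 0) := by
  rintro ⟨B, hB⟩
  have hB1 : 0 < |B| + 1 := by positivity
  have hpos : 0 < (Real.pi * (|B| + 1))⁻¹ := by have := Real.pi_pos; positivity
  obtain ⟨p, q, hpq⟩ := exists_odd_mul_sub_odd_lt hirr hpos
  have h1 := inv_le_norm_inv_charMatrix hirr p q
  set t : ℝ := Real.pi * (2 * p + 1)
  have h2 : ‖(charMatrix α t)⁻¹‖ ≤ growth α |t| :=
    le_csSup (bddAbove_norm_inv_charMatrix hirr |t|) ⟨t, ⟨neg_abs_le t, le_abs_self t⟩, rfl⟩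
  have h3 : growth α |t| ≤ B := hB ⟨|t|, abs_nonneg t, rfl⟩
  have hδ : 0 < |2 * q + 1 - α * (2 * p + 1)| :=
    abs_pos.2 (sub_ne_zero.2 (mul_odd_ne_odd hirr p q).symm)
  have h4 : |B| + 1 ≤ (Real.pi * |2 * q + 1 - α * (2 * p + 1)|)⁻¹ := by
    rw [le_inv_comm₀ hB1 (by positivity)]
    rw [mul_inv, lt_inv_mul_iff₀ Real.pi_pos] at hpq
    exact hpq.le
  linarith [le_abs_self B]

end CharMatrix

end PHS

end

theorem proposition5p2 (α : ℝ) (hα : 0 < α) (hirr : Irrational α) :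
    (∃ T : PHS.C0Semigroup PHS.State, PHS.IsExampleSemigroup α T ∧ PHS.IsContractive α T) ∧
    (∀ T : PHS.C0Semigroup PHS.State,
      PHS.IsExampleSemigroup α T → ¬ PHS.IsExponentiallyStable α T) ∧
    (∀ t : ℝ, IsUnit (PHS.charMatrix α t)) ∧
    ¬ BddAbove (PHS.growth α '' Set.Ici 0) :=
  ⟨PHS.exists_isExampleSemigroup hα, fun _ hT => PHS.not_isExponentiallyStable hα hirr hT,
    PHS.isUnit_charMatrix hirr, PHS.not_bddAbove_growth hirr⟩
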